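/- Types are built from primitive types $p_1,p_2,\dots$ and the unit $\mathbf 1$ by $A\backslash B$, $B/A$, $A\bullet B$, $\Diamond A$, $\Box^{\downarrow}A$. For a set $\mathcal X$ of types, $\operatorname{Tp}(\mathcal X)$ is the smallest superset of $\mathcal X$ closed under these five operations. The length is given by $\|p_i\|=1$, $\|\mathbf 1\|=0$, $\|A\backslash B\|=\|B/A\|=\|A\bullet B\|=\|A\|+\|B\|$, $\|\Diamond A\|=\|\Box^{\downarrow}A\|=\|A\|+2$. A type tree is a type or $\langle\Gamma\rangle$ with $\Gamma$ a type hedge; a type hedge is a finite, possibly empty, sequence of type trees; its yield is the string of types obtained by removing all brackets. A context $\Gamma[\,\cdot\,]$ is a hedge with exactly one hole at the position of a tree, and $\Gamma[\Delta]$ is the result of replacing the hole by the hedge $\Delta$. A sequent is an expression $\Gamma\Rightarrow C$ with $\Gamma$ a type hedge and $C$ a type. The calculus $\mathbf L^{*}_{\mathbf 1}\Diamond$ has initial sequents $p_i\Rightarrow p_i$ and $\Rightarrow\mathbf 1$, and the following rules (hedges may be empty): - from $\Gamma\Rightarrow A$ and $\Delta[B]\Rightarrow C$ infer $\Delta[\Gamma\;A\backslash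 B]\Rightarrow C$, and also $\Delta[B/A\;\Gamma]\Rightarrow C$; - from $A\;\Pi\Rightarrow B$ infer $\Pi\Rightarrow A\backslash B$; from $\Pi\;A\Rightarrow B$ infer $\Pi\Rightarrow B/A$; - from $\Gamma[A\;B]\Rightarrow C$ infer $\Gamma[A\bullet B]\Rightarrow C$; from $\Gamma\Rightarrow A$ and $\Delta\Rightarrow B$ infer $\Gamma\;\Delta\Rightarrow A\bullet B$; - from $\Gamma[\langle A\rangle]\Rightarrow C$ infer $\Gamma[\Diamond A]\Rightarrow C$; from $\Gamma\Rightarrow A$ infer $\langle\Gamma\rangle\Rightarrow\Diamond A$; - from $\Gamma[A]\Rightarrow C$ infer $\Gamma[\langle\Box^{\downarrow}A\rangle]\Rightarrow C$; from $\langle\Gamma\rangle\Rightarrow A$ infer $\Gamma\Rightarrow\Box^{\downarrow}A$; - from $\Gamma[\,]\Rightarrow C$ infer $\Gamma[\mathbf 1]\Rightarrow C$, where $\Gamma[\,]$ has the hole filled by the empty hedge; - (Cut) from $\Gamma\Rightarrow A$ and $\Delta[A]\Rightarrow C$ infer $\Delta[\Gamma]\Rightarrow C$. For a set $\mathcal S$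 of sequents, $\mathcal S\vdash_{\mathrm{Cut}}\Gamma\Rightarrow C$ means that $\Gamma\Rightarrow C$ can be derived from members of $\mathcal S$ using Cut only. Let $\mathcal B$ be a finite set of primitive types, let $m\ge 0$ be an integer, and put $\mathcal G=\operatorname{Tp}(\mathcal B\cup\{\Diamond\mathbf 1\})$ (the guarded types over $\mathcal B$). Let $\mathcal S'_{\mathcal B,m}$ be the set of all sequents $A_1\dots A_n\Rightarrow A_{n+1}$ provable in $\mathbf L^{*}_{\mathbf 1}\Diamond$ with $n\le 2$, $A_i\in\mathcal G$ and $\|A_i\|\le m$ for $1\le i\le n+1$, and let $$\mathcal T'_{\mathcal B,m}=\mathcal S'_{\mathcal B,m}\cup\{\langle\rangle\Rightarrow\Diamond\mathbf 1\}\cup\{\langle A\rangle\Rightarrow\Diamond A\mid A\in\mathcal G,\ \|A\|\le m-2\}\cup\{\langle\Box^{\downarrow}A\rangle\Rightarrow A\mid A\in\mathcal G,\ \|A\|\le m-2\}.$$ **Lemma.** The set $\mathcal T'_{\mathcal B,m}$ is finite. Moreover, if $\Gamma\Rightarrow A_{n+1}$ is a sequent such that the yield of $\Gamma$ is $A_1\dots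 A_n$ ($n\ge 0$), where $A_i\in\mathcal G$ and $\|A_i\|\le m$ for $i=1,\dots,n+1$, then $\Gamma\Rightarrow A_{n+1}$ is provable in $\mathbf L^{*}_{\mathbf 1}\Diamond$ if and only if $\mathcal T'_{\mathcal B,m}\vdash_{\mathrm{Cut}}\Gamma\Rightarrow A_{n+1}$. -/

import Mathlib

namespace LambekBrackets

/-- The types of the Lambek calculus with brackets and unit, i.e. the elements of `Tp(Pr ∪ {1})`,
where the primitive types `Pr` are indexed by the natural numbers. -/
inductive Ty : Type
  | prim (i : ℕ) : Ty
  | one : Ty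
  /-- `ldiv A B` is `A \ B`. -/
  | ldiv (A B : Ty) : Ty
  /-- `rdiv B A` is `B / A`. -/
  | rdiv (B A : Ty) : Ty
  | prod (A B : Ty) : Ty
  | dia (A : Ty) : Ty
  | box (A : Ty) : Ty

/-- The length `‖A‖` of a type; the unit has length `0`. -/
def Ty.length : Ty → ℕ
  | .prim _ => 1
  | .one => 0
  | .ldiv A B => A.length + B.length
  | .rdiv B A => B.length + A.length
  | .prod A B => A.length + B.length
  | .dia A => A.length + 2
  | .box A => A.length + 2

/-- `Tp S` is the smallest superset of `S` closed under all the type-forming operations. -/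
inductive Tp (S : Set Ty) : Ty → Prop
  | base {A : Ty} : A ∈ S → Tp S A
  | ldiv {A B : Ty} : Tp S A → Tp S B → Tp S (.ldiv A B)
  | rdiv {A B : Ty} : Tp S A → Tp S B → Tp S (.rdiv B A)
  | prod {A B : Ty} : Tp S A → Tp S B → Tp S (.prod A B)
  | dia {A : Ty} : Tp S A → Tp S (.dia A)
  | box {A : Ty} : Tp S A → Tp S (.box A)

/-- The guarded types over a finite set `B` of primitive types: the elements of
`Tp(B ∪ {◇1})`. -/
def Guarded (B : Finset ℕ) (A : Ty) : Prop :=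
  Tp (Ty.prim '' (B : Set ℕ) ∪ {Ty.dia Ty.one}) A

/-- Type trees: a single node labeled by a type, or an unlabeled root with a finite (possibly
empty) sequence of immediate subtrees, written `⟨T₁ … Tₙ⟩`. -/
inductive Tree : Type
  | leaf (A : Ty) : Tree
  | node (ts : List Tree) : Tree

/-- Type hedges are finite, possibly empty, sequences of type trees. -/
abbrev Hedge : Type := List Tree

mutual
/-- The string of types labeling the leaves of a type tree. -/
def Tree.yield : Tree → List Ty
  | .leaf A => [A]
  | .node ts => hedgeYield ts
/-- The yield of a type hedge. -/
def hedgeYield : List Tree → List Ty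
  | [] => []
  | t :: ts => t.yield ++ hedgeYield ts
end

/-- Contexts: hedges with exactly one hole `■`, which is either one of the roots (`Π₁ ■ Π₂`) or
lies inside the bracket of exactly one of the trees (`Π₁ ⟨Γ[■]⟩ Π₂`). -/
inductive Ctx : Type
  | hole (L R : Hedge) : Ctx
  | node (L : Hedge) (c : Ctx) (R : Hedge) : Ctx

/-- `c.fill Δ` is `Γ[Δ]`, the hedge obtained by replacing the hole by the hedge `Δ`. -/
def Ctx.fill : Ctx → Hedge → Hedge
  | .hole L R, Δ => L ++ Δ ++ R
  | .node L c R, Δ => L ++ [Tree.node (c.fill Δ)] ++ R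

/-- `Provable Γ C` says that the sequent `Γ ⇒ C` is provable in the Lambek calculus with brackets
and unit allowing empty antecedents. -/
inductive Provable : Hedge → Ty → Prop
  | init (i : ℕ) : Provable [.leaf (.prim i)] (.prim i)
  | ldivL (Δ : Ctx) (Γ : Hedge) (A B C : Ty) :
      Provable Γ A → Provable (Δ.fill [.leaf B]) C →
      Provable (Δ.fill (Γ ++ [.leaf (.ldiv A B)])) C
  | ldivR (Γ : Hedge) (A B : Ty) :
      Provable (.leaf A :: Γ) B → Provable Γ (.ldiv A B)
  | rdivL (Δ : Ctx) (Γ : Hedge) (A B C : Ty) :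
      Provable Γ A → Provable (Δ.fill [.leaf B]) C →
      Provable (Δ.fill (.leaf (.rdiv B A) :: Γ)) C
  | rdivR (Γ : Hedge) (A B : Ty) :
      Provable (Γ ++ [.leaf A]) B → Provable Γ (.rdiv B A)
  | prodL (Γ : Ctx) (A B C : Ty) :
      Provable (Γ.fill [.leaf A, .leaf B]) C → Provable (Γ.fill [.leaf (.prod A B)]) C
  | prodR (Γ Δ : Hedge) (A B : Ty) :
      Provable Γ A → Provable Δ B → Provable (Γ ++ Δ) (.prod A B)
  | diaL (Γ : Ctx) (A C : Ty) :
      Provable (Γ.fill [.node [.leaf A]]) C → Provable (Γ.fill [.leaf (.dia A)]) C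
  | diaR (Γ : Hedge) (A : Ty) :
      Provable Γ A → Provable [.node Γ] (.dia A)
  | boxL (Γ : Ctx) (A C : Ty) :
      Provable (Γ.fill [.leaf A]) C → Provable (Γ.fill [.node [.leaf (.box A)]]) C
  | boxR (Γ : Hedge) (A : Ty) :
      Provable [.node Γ] A → Provable Γ (.box A)
  | oneL (Γ : Ctx) (C : Ty) :
      Provable (Γ.fill []) C → Provable (Γ.fill [.leaf .one]) C
  | oneR : Provable [] .one
  | cut (Δ : Ctx) (Γ : Hedge) (A C : Ty) :
      Provable Γ A → Provable (Δ.fill [.leaf A]) C → Provable (Δ.fill Γ) C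

/-- Sequents `Γ ⇒ C`. -/
structure Sequent : Type where
  antecedent : Hedge
  succedent : Ty

/-- `CutDerivable S Γ C` says that the sequent `Γ ⇒ C` can be derived from `S` using Cut only. -/
inductive CutDerivable (S : Set Sequent) : Hedge → Ty → Prop
  | mem (Γ : Hedge) (C : Ty) : (⟨Γ, C⟩ : Sequent) ∈ S → CutDerivable S Γ C
  | cut (Δ : Ctx) (Γ : Hedge) (A C : Ty) :
      CutDerivable S Γ A → CutDerivable S (Δ.fill [.leaf A]) C →
      CutDerivable S (Δ.fill Γ) C

/-- `S'_{B,m}`: the provable bracket-free sequents `A₁ … Aₙ ⇒ Aₙ₊₁` with `n ≤ 2`, all of whose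
types are guarded types over `B` of length at most `m`. -/
def setS (B : Finset ℕ) (m : ℕ) : Set Sequent :=
  {s | ∃ (As : List Ty) (C : Ty),
    As.length ≤ 2 ∧
    (∀ A ∈ As, Guarded B A ∧ A.length ≤ m) ∧
    (Guarded B C ∧ C.length ≤ m) ∧
    Provable (As.map Tree.leaf) C ∧
    s = ⟨As.map Tree.leaf, C⟩}

/-- `T'_{B,m}`: the set `S'_{B,m}` together with `⟨⟩ ⇒ ◇1` and all `⟨A⟩ ⇒ ◇A` and `⟨□A⟩ ⇒ A` with
`A` a guarded type over `B` and `‖A‖ ≤ m - 2` (as integers, that is, `‖A‖ + 2 ≤ m`). -/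
def setT (B : Finset ℕ) (m : ℕ) : Set Sequent :=
  setS B m ∪
  {⟨[.node []], .dia .one⟩} ∪
  {s | ∃ A : Ty, Guarded B A ∧ A.length + 2 ≤ m ∧ s = ⟨[.node [.leaf A]], .dia A⟩} ∪
  {s | ∃ A : Ty, Guarded B A ∧ A.length + 2 ≤ m ∧ s = ⟨[.node [.leaf (.box A)]], A⟩}

end LambekBrackets

namespace LambekBrackets

-- The nontrivial direction adapts Pentus's argument to brackets. Hedges are written as token
-- strings, and every primitive type and every pair of brackets (in the antecedent, or of a
-- modality) receives a label. A labelled type spells a word whose number of letters is its length,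
-- each modality contributing an opening and a closing letter. A labelled sequent is thin if it is
-- derivable without Cut and no letter occurs more than twice in it.
--
-- Every provable sequent of guarded types has a thin labelling. This is a semantic cut elimination:
-- in a phase model built from labellable sequents all rules, Cut and the unit rules included, are
-- sound (`Provable.mem_interp`), while a guarded type A lies in its own interpretation and
-- everything in that interpretation labellably derives A (`Guarded.interp`). Guardedness allows ◇1
-- to be treated as an atom with its own two rules, so 1 disappears.
--
-- A thin sequent is cut into smaller ones by Maehara interpolation (`LDer.interpolation`): an
-- interpolant E of a nonempty balanced factor has no letter more often than the factor or the rest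
-- of the sequent does. By thinness each letter of E occurs exactly once on each side, so the length
-- of E is at most the number of letters crossing the border of the factor.
--
-- That number is controlled by a group invariant. Letters evaluate to involutions, division to
-- inverse multiplication, and derivable sequents to equalities (`LDer.prod_eq`). Testing in the
-- symmetric group on three points shows that the two-fold letters of a thin sequent are paired in a
-- noncrossing way. Two consequences follow. In a bracket-free sequent with at least two antecedent
-- types some neighbours have an interpolant of length at most m (`Thin.exists_pair`). For a bracket
-- pair, the second occurrence of its two letters lies in a single type of length at most m, and all
-- letters crossing the bracket lie strictly between those two inside that type; hence the
-- interpolant has length at most m - 2 (`Thin.bracket`), and one of the bracket axioms removes the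
-- pair. Induction on the number of tokens gives `Thin.cutDerivable`.
--
-- Conversely all the axioms are provable. Finiteness holds because guarded types have positive
-- length.

/-- Tokens of the linear notation for hedges: types, opening and closing brackets. -/
inductive Tok (α β : Type) : Type
  | ty (A : α) : Tok α β
  | op (j : β) : Tok α β
  | cl (j : β) : Tok α β

namespace Tok

variable {α β : Type}

/-- The contribution of a token to the bracket depth. -/
def depth : Tok α β → ℤ
  | ty _ => 0
  | op _ => 1
  | cl _ => -1

end Tok

-- Well-bracketed token strings

section Balanced

variable {α β : Type}

/-- The number of opening brackets minus the number of closing brackets. -/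
def height (l : List (Tok α β)) : ℤ := (l.map Tok.depth).sum

@[simp] theorem height_nil : height ([] : List (Tok α β)) = 0 := rfl

@[simp] theorem height_ty (A : α) (l : List (Tok α β)) : height (.ty A :: l) = height l := by
  simp [height, Tok.depth]

@[simp] theorem height_op (j : β) (l : List (Tok α β)) : height (.op j :: l) = 1 + height l := by
  simp [height, Tok.depth]

@[simp] theorem height_cl (j : β) (l : List (Tok α β)) : height (.cl j :: l) = -1 + height l := by
  simp [height, Tok.depth]

@[simp] theorem height_append (l l' : List (Tok α β)) :
    height (l ++ l') = height l + height l' := by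
  simp [height]

/-- Well-bracketed token strings, matching brackets carrying the same label. -/
inductive Bal : List (Tok α β) → Prop
  | nil : Bal []
  | ty (A : α) {l : List (Tok α β)} : Bal l → Bal (.ty A :: l)
  | br (j : β) {l₁ l₂ : List (Tok α β)} : Bal l₁ → Bal l₂ → Bal (.op j :: (l₁ ++ .cl j :: l₂))

/-- The three possible positions of a token in a string split into three parts. -/
theorem three_split {γ : Type} {X M Y L R : List γ} {t : γ} (h : X ++ (M ++ Y) = L ++ t :: R) :
    (∃ X', X = L ++ t :: X' ∧ R = X' ++ (M ++ Y)) ∨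
    (∃ M₁ M₂, M = M₁ ++ t :: M₂ ∧ L = X ++ M₁ ∧ R = M₂ ++ Y) ∨
    (∃ Y₁, Y = Y₁ ++ t :: R ∧ L = X ++ (M ++ Y₁)) := by
  rcases List.append_eq_append_iff.1 h with ⟨as, rfl, h2⟩ | ⟨bs, rfl, h2⟩
  · rcases List.append_eq_append_iff.1 h2 with ⟨as', rfl, h3⟩ | ⟨bs', rfl, h3⟩
    · exact .inr (.inr ⟨as', h3, by simp⟩)
    · cases bs' with
      | nil => exact .inr (.inr ⟨[], by simpa using h3.symm, by simp⟩)
      | cons b bs' =>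
        simp only [List.cons_append, List.cons.injEq] at h3
        obtain ⟨rfl, rfl⟩ := h3
        exact .inr (.inl ⟨as, bs', rfl, rfl, rfl⟩)
  · cases bs with
    | nil =>
      simp only [List.nil_append] at h2
      cases M with
      | nil => exact .inr (.inr ⟨[], by simpa using h2.symm, by simp⟩)
      | cons b M =>
        simp only [List.cons_append, List.cons.injEq] at h2
        obtain ⟨rfl, rfl⟩ := h2
        exact .inr (.inl ⟨[], M, rfl, by simp, rfl⟩)
    | cons b bs =>
      simp only [List.cons_append, List.cons.injEq] at h2
      obtain ⟨rfl, rfl⟩ := h2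
      exact .inl ⟨bs, rfl, rfl⟩

namespace Bal

theorem append {l l' : List (Tok α β)} (h : Bal l) (h' : Bal l') : Bal (l ++ l') := by
  induction h with
  | nil => exact h'
  | ty A _ ih => exact ih.ty A
  | br j h₁ _ _ ih₂ => simpa using h₁.br j ih₂

theorem height_eq {l : List (Tok α β)} (h : Bal l) : height l = 0 := by
  induction h with
  | nil => rfl
  | ty A _ ih => simpa using ih
  | br j _ _ ih₁ ih₂ => simp [ih₁, ih₂]

/-- Heights never drop below zero along a balanced string, and they return to zero only between
top-level items. This reduces the later questions about overlapping factors to arithmetic of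
heights. -/
theorem of_prefix {l : List (Tok α β)} (h : Bal l) : ∀ {P Q : List (Tok α β)}, l = P ++ Q →
    0 ≤ height P ∧ (height P = 0 → Bal P ∧ Bal Q) := by
  induction h with
  | nil =>
    intro P Q e
    obtain ⟨rfl, rfl⟩ := List.append_eq_nil_iff.1 e.symm
    exact ⟨le_rfl, fun _ => ⟨nil, nil⟩⟩
  | ty A h ih =>
    intro P Q e
    cases P with
    | nil =>
      obtain rfl : _ = Q := e
      exact ⟨le_rfl, fun _ => ⟨nil, h.ty A⟩⟩
    | cons t P =>
      simp only [List.cons_append, List.cons.injEq] at e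
      obtain ⟨rfl, e⟩ := e
      obtain ⟨i1, i2⟩ := ih e
      simp only [height_ty]
      exact ⟨i1, fun h0 => ⟨(i2 h0).1.ty A, (i2 h0).2⟩⟩
  | br j h₁ h₂ ih₁ ih₂ =>
    intro P Q e
    cases P with
    | nil =>
      obtain rfl : _ = Q := e
      exact ⟨le_rfl, fun _ => ⟨nil, h₁.br j h₂⟩⟩
    | cons t P =>
      simp only [List.cons_append, List.cons.injEq] at e
      obtain ⟨rfl, e⟩ := e
      rcases List.append_eq_append_iff.1 e with ⟨as, rfl, e2⟩ | ⟨bs, e1, e2⟩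
      · cases as with
        | nil =>
          simp only [List.append_nil, height_op, h₁.height_eq]
          exact ⟨by norm_num, fun h0 => by norm_num at h0⟩
        | cons b as =>
          simp only [List.cons_append, List.cons.injEq] at e2
          obtain ⟨rfl, e2⟩ := e2
          obtain ⟨i1, i2⟩ := ih₂ e2
          simp only [height_op, height_append, height_cl, h₁.height_eq]
          refine ⟨by linarith, fun h0 => ?_⟩
          obtain ⟨b1, b2⟩ := i2 (by linarith)
          exact ⟨h₁.br j b1, b2⟩
      · obtain ⟨i1, -⟩ := ih₁ e1
        simp only [height_op]
        exact ⟨by linarith, fun h0 => by linarith⟩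

theorem height_prefix {P Q : List (Tok α β)} (h : Bal (P ++ Q)) : 0 ≤ height P :=
  (h.of_prefix rfl).1

theorem height_suffix {P Q : List (Tok α β)} (h : Bal (P ++ Q)) : height Q ≤ 0 := by
  have h1 := h.height_prefix
  have h2 := h.height_eq
  simp only [height_append] at h2
  linarith

theorem split {P Q : List (Tok α β)} (h : Bal (P ++ Q)) (h0 : height P = 0) : Bal P ∧ Bal Q :=
  (h.of_prefix rfl).2 h0

/-- As a suffix of a balanced string `Q` has height at most zero, as a prefix of another at least
zero; so both strings are cut at top level. -/
theorem overlap {P Q R : List (Tok α β)} (h : Bal (P ++ Q)) (h' : Bal (Q ++ R)) :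
    Bal P ∧ Bal Q ∧ Bal R := by
  have h1 := h.height_suffix
  have h2 := h'.height_prefix
  have h3 := h.height_eq
  simp only [height_append] at h3
  exact ⟨(h.split (by linarith)).1, h'.split (by linarith)⟩

theorem of_ty {A : α} {l : List (Tok α β)} (h : Bal (.ty A :: l)) : Bal l := by
  cases h; assumption

theorem replace {l : List (Tok α β)} (h : Bal l) : ∀ {L M M' R : List (Tok α β)},
    l = L ++ (M ++ R) → Bal M → Bal M' → Bal (L ++ (M' ++ R)) := by
  induction h with
  | nil =>
    intro L M M' R e hM hM'
    obtain ⟨rfl, e'⟩ := List.append_eq_nil_iff.1 e.symm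
    obtain ⟨rfl, rfl⟩ := List.append_eq_nil_iff.1 e'
    simpa using hM'
  | ty A h ih =>
    intro L M M' R e hM hM'
    cases L with
    | nil =>
      have hb : Bal (M ++ R) := (show _ = M ++ R from e) ▸ h.ty A
      exact hM'.append (hb.split hM.height_eq).2
    | cons t L =>
      simp only [List.cons_append, List.cons.injEq] at e
      obtain ⟨rfl, e⟩ := e
      exact (ih e hM hM').ty A
  | br j h₁ h₂ ih₁ ih₂ =>
    intro L M M' R e hM hM'
    cases L with
    | nil =>
      have hb : Bal (M ++ R) := by
        have := h₁.br j h₂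
        rwa [e] at this
      exact hM'.append (hb.split hM.height_eq).2
    | cons t L =>
      simp only [List.cons_append, List.cons.injEq] at e
      obtain ⟨rfl, e⟩ := e
      rcases three_split e.symm with ⟨X', rfl, e2⟩ | ⟨M₁, M₂, rfl, e2, e3⟩ | ⟨Y₁, rfl, e2⟩
      · simpa using h₁.br j (ih₂ e2 hM hM')
      -- The closing bracket of the outer pair would fall inside `M`. Then `M₁` is a suffix of the
      -- balanced `l₁`, so `M₁` followed by that bracket is a prefix of `M` of negative height.
      · exfalso
        subst e2
        have q1 := h₁.height_suffix
        have q2 : Bal ((M₁ ++ [Tok.cl j]) ++ M₂) := by simpa using hM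
        have q3 := q2.height_prefix
        simp at q3
        linarith
      · have := (ih₁ e2 hM hM').br j h₂
        simpa using this

theorem replace' {L M M' R : List (Tok α β)} (h : Bal (L ++ (M ++ R))) (hM : Bal M)
    (hM' : Bal M') : Bal (L ++ (M' ++ R)) :=
  h.replace rfl hM hM'

theorem exists_bracket {l : List (Tok α β)} (h : Bal l) :
    (∃ As : List α, l = As.map Tok.ty) ∨
    ∃ X j M Y, l = X ++ (.op j :: (M ++ .cl j :: Y)) ∧ Bal M := by
  induction h with
  | nil => exact .inl ⟨[], rfl⟩
  | ty A h ih =>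
    rcases ih with ⟨As, rfl⟩ | ⟨X, j, M, Y, rfl, hM⟩
    · exact .inl ⟨A :: As, rfl⟩
    · exact .inr ⟨.ty A :: X, j, M, Y, rfl, hM⟩
  | br j h₁ h₂ _ _ => exact .inr ⟨[], j, _, _, rfl, h₁⟩

/-- The partner of an opening bracket is determined by balance alone, so any balanced stretch
between two brackets exhibits a matching pair. Needed to recover equal labels after labels have been
forgotten. -/
theorem label_eq {l : List (Tok α β)} (h : Bal l) : ∀ {L M R : List (Tok α β)} {i j : β},
    l = L ++ (.op i :: (M ++ .cl j :: R)) → Bal M → i = j := by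
  induction h with
  | nil => intro L M R i j e _; simp at e
  | ty A h ih =>
    intro L M R i j e hM
    cases L with
    | nil => simp at e
    | cons t L =>
      simp only [List.cons_append, List.cons.injEq] at e
      exact ih e.2 hM
  | @br k l₁ l₂ h₁ h₂ ih₁ ih₂ =>
    intro L M R i j e hM
    cases L with
    | nil =>
      simp only [List.nil_append, List.cons.injEq, Tok.op.injEq] at e
      obtain ⟨rfl, e⟩ := e
      rcases List.append_eq_append_iff.1 e with ⟨as, rfl, e2⟩ | ⟨bs, rfl, e2⟩
      · cases as with
        | nil => simp_all
        | cons b as =>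
          simp only [List.cons_append, List.cons.injEq] at e2
          obtain ⟨rfl, e2⟩ := e2
          have q := hM.height_suffix
          have q2 : Bal ((l₁ ++ [Tok.cl k]) ++ as) := by simpa using hM
          have q3 := q2.height_prefix
          simp [h₁.height_eq] at q3
      · cases bs with
        | nil => simp_all
        | cons b bs =>
          simp only [List.cons_append, List.cons.injEq] at e2
          obtain ⟨rfl, e2⟩ := e2
          have q2 : Bal ((M ++ [Tok.cl j]) ++ bs) := by simpa using h₁
          have q3 := q2.height_prefix
          simp [hM.height_eq] at q3
    | cons t L =>
      simp only [List.cons_append, List.cons.injEq] at e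
      obtain ⟨rfl, e⟩ := e
      have e' : L ++ ((.op i :: (M ++ [.cl j])) ++ R) = l₁ ++ .cl k :: l₂ := by simpa using e.symm
      rcases three_split e' with ⟨X', rfl, e2⟩ | ⟨M₁, M₂, e1, e2, e3⟩ | ⟨Y₁, rfl, e2⟩
      · exact ih₂ (by simpa using e2) hM
      · exfalso
        subst e2
        have q1 := h₁.height_suffix
        cases M₁ with
        | nil => simp at e1
        | cons b M₁ =>
          simp only [List.cons_append, List.cons.injEq] at e1
          obtain ⟨rfl, e1⟩ := e1
          rcases List.append_eq_append_iff.1 e1 with ⟨as, rfl, e2⟩ | ⟨bs, rfl, e2⟩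
          · have := hM.height_eq
            cases as with
            | nil => simp at q1; linarith
            | cons b as => simp at e2
          · have := hM.height_prefix
            simp at q1; linarith
      · exact ih₁ (by simpa using e2) hM

end Bal

end Balanced

-- Labelled types and their words

/-- Letters: labelled occurrences of primitive types and of brackets. -/
inductive Letter : Type
  | prim (i x : ℕ) : Letter
  | opn (j : ℕ) : Letter
  | cls (j : ℕ) : Letter
  deriving DecidableEq

/-- Labelled guarded types; `unitDia j` stands for `◇1`. -/
inductive LTy : Type
  | prim (i x : ℕ) : LTy
  | unitDia (j : ℕ) : LTy
  | ldiv (A B : LTy) : LTy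
  | rdiv (B A : LTy) : LTy
  | prod (A B : LTy) : LTy
  | dia (j : ℕ) (A : LTy) : LTy
  | box (j : ℕ) (A : LTy) : LTy

namespace LTy

/-- Forgetting the labels. -/
def erase : LTy → Ty
  | prim i _ => .prim i
  | unitDia _ => .dia .one
  | ldiv A B => .ldiv A.erase B.erase
  | rdiv B A => .rdiv B.erase A.erase
  | prod A B => .prod A.erase B.erase
  | dia _ A => .dia A.erase
  | box _ A => .box A.erase

/-- The word of a labelled type in the free product of groups of order two. -/
def word : LTy → List Letter
  | prim i x => [.prim i x]
  | unitDia j => [.opn j] ++ [.cls j]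
  | ldiv A B => A.word.reverse ++ B.word
  | rdiv B A => B.word ++ A.word.reverse
  | prod A B => A.word ++ B.word
  | dia j A => [.opn j] ++ (A.word ++ [.cls j])
  | box j A => [.opn j] ++ (A.word ++ [.cls j])

/-- The summand 2 in the length of a modality counts its opening and its closing letter. -/
theorem length_word (A : LTy) : A.word.length = A.erase.length := by
  induction A <;> simp_all [word, erase, Ty.length]

/-- The number of occurrences of a letter in a labelled type. -/
def cnt (q : Letter) (A : LTy) : ℕ := A.word.count q

end LTy

abbrev LTok : Type := Tok LTy ℕ

/-- The word of a labelled token. -/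
def tokWord : LTok → List Letter
  | .ty A => A.word
  | .op j => [.opn j]
  | .cl j => [.cls j]

/-- The word of a string of labelled tokens. -/
def words (l : List LTok) : List Letter := l.flatMap tokWord

theorem words_nil : words [] = [] := rfl

theorem words_cons (t : LTok) (l : List LTok) : words (t :: l) = tokWord t ++ words l := rfl

theorem words_append (l l' : List LTok) : words (l ++ l') = words l ++ words l' := by
  simp [words]

/-- The number of occurrences of a letter in a string of labelled tokens. -/
def wcnt (q : Letter) (l : List LTok) : ℕ := (words l).count q

section Counting

variable (q : Letter)

theorem wcnt_nil : wcnt q [] = 0 := rfl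

theorem wcnt_append (l l' : List LTok) : wcnt q (l ++ l') = wcnt q l + wcnt q l' := by
  simp only [wcnt, words_append, List.count_append]

theorem wcnt_ty (A : LTy) (l : List LTok) : wcnt q (.ty A :: l) = A.cnt q + wcnt q l := by
  simp only [wcnt, words_cons, List.count_append]; rfl

theorem wcnt_op (j : ℕ) (l : List LTok) :
    wcnt q (.op j :: l) = [Letter.opn j].count q + wcnt q l := by
  simp only [wcnt, words_cons, List.count_append]; rfl

theorem wcnt_cl (j : ℕ) (l : List LTok) :
    wcnt q (.cl j :: l) = [Letter.cls j].count q + wcnt q l := by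
  simp only [wcnt, words_cons, List.count_append]; rfl

theorem cnt_unitDia (j : ℕ) :
    (LTy.unitDia j).cnt q = [Letter.opn j].count q + [Letter.cls j].count q := by
  simp only [LTy.cnt, LTy.word, List.count_append]

theorem cnt_ldiv (A B : LTy) : (LTy.ldiv A B).cnt q = A.cnt q + B.cnt q := by
  simp only [LTy.cnt, LTy.word, List.count_append, List.count_reverse]

theorem cnt_rdiv (A B : LTy) : (LTy.rdiv B A).cnt q = B.cnt q + A.cnt q := by
  simp only [LTy.cnt, LTy.word, List.count_append, List.count_reverse]

theorem cnt_prod (A B : LTy) : (LTy.prod A B).cnt q = A.cnt q + B.cnt q := by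
  simp only [LTy.cnt, LTy.word, List.count_append]

theorem cnt_dia (j : ℕ) (A : LTy) : (LTy.dia j A).cnt q =
    [Letter.opn j].count q + (A.cnt q + [Letter.cls j].count q) := by
  simp only [LTy.cnt, LTy.word, List.count_append]

theorem cnt_box (j : ℕ) (A : LTy) : (LTy.box j A).cnt q =
    [Letter.opn j].count q + (A.cnt q + [Letter.cls j].count q) := by
  simp only [LTy.cnt, LTy.word, List.count_append]

end Counting

theorem LTy.cnt_opn_eq_cnt_cls (j : ℕ) (A : LTy) : A.cnt (.opn j) = A.cnt (.cls j) := by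
  induction A with
  | prim i x => simp [cnt, word]
  | unitDia k => simp [cnt, word, List.count_cons]
  | ldiv A B ihA ihB => simp only [cnt_ldiv, ihA, ihB]
  | rdiv A B ihA ihB => simp only [cnt_rdiv, ihA, ihB]
  | prod A B ihA ihB => simp only [cnt_prod, ihA, ihB]
  | dia k A ih => simp [cnt_dia, ih, List.count_cons]; omega
  | box k A ih => simp [cnt_box, ih, List.count_cons]; omega

-- The labelled cut-free calculus

open Tok in
/-- The cut-free and unit-free calculus of labelled sequents in linear notation. -/
inductive LDer : List LTok → LTy → Prop
  | init (i x : ℕ) : LDer [ty (.prim i x)] (.prim i x)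
  | ldivL {L Γ R : List LTok} {A B C : LTy} : LDer Γ A → LDer (L ++ ty B :: R) C →
      LDer (L ++ (Γ ++ ty (.ldiv A B) :: R)) C
  | ldivR {Γ : List LTok} {A B : LTy} : LDer (ty A :: Γ) B → LDer Γ (.ldiv A B)
  | rdivL {L Γ R : List LTok} {A B C : LTy} : LDer Γ A → LDer (L ++ ty B :: R) C →
      LDer (L ++ ty (.rdiv B A) :: (Γ ++ R)) C
  | rdivR {Γ : List LTok} {A B : LTy} : LDer (Γ ++ [ty A]) B → LDer Γ (.rdiv B A)
  | prodL {L R : List LTok} {A B C : LTy} : LDer (L ++ ty A :: ty B :: R) C →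
      LDer (L ++ ty (.prod A B) :: R) C
  | prodR {Γ Δ : List LTok} {A B : LTy} : LDer Γ A → LDer Δ B → LDer (Γ ++ Δ) (.prod A B)
  | diaL {L R : List LTok} {A C : LTy} {j : ℕ} : LDer (L ++ op j :: ty A :: cl j :: R) C →
      LDer (L ++ ty (.dia j A) :: R) C
  | diaR {Γ : List LTok} {A : LTy} (j : ℕ) : LDer Γ A → LDer (op j :: (Γ ++ [cl j])) (.dia j A)
  | boxL {L R : List LTok} {A C : LTy} (j : ℕ) : LDer (L ++ ty A :: R) C →
      LDer (L ++ op j :: ty (.box j A) :: cl j :: R) C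
  -- Balance of `Γ` must be demanded: from `op j, cl j, op j, cl j` one could otherwise strip the
  -- outer tokens and keep `cl j, op j`.
  | boxR {Γ : List LTok} {A : LTy} {j : ℕ} : Bal Γ → LDer (op j :: (Γ ++ [cl j])) A →
      LDer Γ (.box j A)
  | unitDiaL {L R : List LTok} {C : LTy} {j : ℕ} : LDer (L ++ op j :: cl j :: R) C →
      LDer (L ++ ty (.unitDia j) :: R) C
  | unitDiaR (j : ℕ) : LDer [op j, cl j] (.unitDia j)

theorem Bal.single {α β : Type} (A : α) : Bal ([.ty A] : List (Tok α β)) := Bal.nil.ty A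

theorem Bal.bracket {α β : Type} (j : β) {l : List (Tok α β)} (h : Bal l) :
    Bal (.op j :: (l ++ [.cl j])) := h.br j .nil

/-- The condition on prefixes guarantees that the first and last tokens match each other, rather
than belonging to two neighbouring brackets. -/
theorem Bal.of_bracket {α β : Type} {i j : β} {l : List (Tok α β)}
    (h : Bal (.op i :: (l ++ [.cl j]))) (hp : ∀ P Q, l = P ++ Q → 0 ≤ height P) : Bal l := by
  generalize e : (Tok.op i :: (l ++ [Tok.cl j])) = l' at h
  cases h with
  | nil => simp at e
  | ty => simp at e
  | @br k l₁ l₂ h₁ h₂ =>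
    simp only [List.cons.injEq] at e
    rcases List.append_eq_append_iff.1 e.2 with ⟨as, rfl, e2⟩ | ⟨bs, rfl, e2⟩
    · cases as with
      | nil => simpa using h₁
      | cons b as => simp at e2
    · cases bs with
      | nil => simpa using h₁
      | cons b bs =>
        simp only [List.cons_append, List.cons.injEq] at e2
        obtain ⟨rfl, rfl⟩ := e2
        have := hp (l₁ ++ [.cl k]) bs (by simp)
        simp [h₁.height_eq] at this

theorem LDer.bal {l : List LTok} {C : LTy} (h : LDer l C) : Bal l := by
  induction h with
  | init i x => exact Bal.single _
  | @ldivL L Γ R A B C _ _ ih₁ ih₂ =>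
    simpa using Bal.replace' (M := [.ty B]) (M' := Γ ++ [.ty (.ldiv A B)]) ih₂ (Bal.single _)
      (ih₁.append (Bal.single _))
  | ldivR _ ih => exact ih.of_ty
  | @rdivL L Γ R A B C _ _ ih₁ ih₂ =>
    simpa using Bal.replace' (M := [.ty B]) (M' := .ty (.rdiv B A) :: Γ) ih₂ (Bal.single _)
      (ih₁.ty _)
  | rdivR _ ih => exact (ih.split (by simpa using ih.height_eq)).1
  | @prodL L R A B C _ ih =>
    exact Bal.replace' (M := [.ty A, .ty B]) (M' := [.ty (.prod A B)]) ih ((Bal.single _).ty _)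
      (Bal.single _)
  | prodR _ _ ih₁ ih₂ => exact ih₁.append ih₂
  | @diaL L R A C j _ ih =>
    exact Bal.replace' (M := [.op j, .ty A, .cl j]) (M' := [.ty (.dia j A)]) ih
      ((Bal.single A).bracket j) (Bal.single _)
  | diaR j _ ih => exact ih.bracket j
  | @boxL L R A C j _ ih =>
    exact Bal.replace' (M := [.ty A]) (M' := [.op j, .ty (.box j A), .cl j]) ih (Bal.single _)
      ((Bal.single (LTy.box j A)).bracket j)
  | boxR h _ _ => exact h
  | @unitDiaL L R C j _ ih =>
    exact Bal.replace' (M := [.op j, .cl j]) (M' := [.ty (.unitDia j)]) ih (Bal.nil.bracket j)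
      (Bal.single _)
  | unitDiaR j => exact Bal.nil.bracket j

open Tok

theorem Bal.ne_cl {α β : Type} {j : β} {l : List (Tok α β)} (h : Bal (cl j :: l)) : False := by
  have := h.height_prefix (P := [cl j])
  simp at this

theorem Bal.bracket_split {α β : Type} {j : β} {Γ X Φ Y : List (Tok α β)} (hΓ : Bal Γ)
    (e : op j :: (Γ ++ [cl j]) = X ++ (Φ ++ Y)) (hb : Bal Φ) (hne : Φ ≠ []) :
    (X = [] ∧ Y = [] ∧ Φ = op j :: (Γ ++ [cl j])) ∨
    ∃ X' Y', X = op j :: X' ∧ Y = Y' ++ [cl j] ∧ Γ = X' ++ (Φ ++ Y') := by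
  cases X with
  | nil =>
    left
    cases Φ with
    | nil => exact absurd rfl hne
    | cons t Φ =>
      simp only [List.nil_append, List.cons_append, List.cons.injEq] at e
      obtain ⟨rfl, e⟩ := e
      have h0 := hb.height_eq
      rcases List.append_eq_append_iff.1 e with ⟨as, rfl, e2⟩ | ⟨bs, rfl, e2⟩
      · cases as with
        | nil => simp [hΓ.height_eq] at h0
        | cons b as =>
          simp only [List.cons_append, List.cons.injEq, List.nil_eq, List.append_eq_nil_iff] at e2
          obtain ⟨rfl, rfl, rfl⟩ := e2
          simp
      · have := hΓ.height_prefix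
        simp at h0; linarith
  | cons t X =>
    right
    simp only [List.cons_append, List.cons.injEq] at e
    obtain ⟨rfl, e⟩ := e
    rcases List.append_eq_append_iff.1 e with ⟨as, rfl, e2⟩ | ⟨bs, rfl, e2⟩
    · cases as with
      | nil =>
        cases Φ with
        | nil => exact absurd rfl hne
        | cons b Φ =>
          simp only [List.nil_append, List.cons_append, List.cons.injEq] at e2
          obtain ⟨rfl, -⟩ := e2
          exact hb.ne_cl.elim
      | cons b as =>
        simp only [List.cons_append, List.cons.injEq, List.nil_eq, List.append_eq_nil_iff] at e2
        exact absurd e2.2.2.1 hne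
    · rcases List.append_eq_append_iff.1 e2 with ⟨a', rfl, rfl⟩ | ⟨c', rfl, e3⟩
      · exact ⟨X, a', rfl, rfl, rfl⟩
      · cases c' with
        | nil => exact ⟨X, [], rfl, by simpa using e3.symm, by simp⟩
        | cons b c' =>
          simp only [List.cons_append, List.cons.injEq, List.nil_eq, List.append_eq_nil_iff] at e3
          obtain ⟨rfl, rfl, rfl⟩ := e3
          have h1 := hΓ.height_suffix
          have h0 := hb.height_eq
          simp at h0; linarith

-- Interpolation

/-- Maehara interpolation with control over the occurrences of letters. -/
theorem LDer.interpolation {l : List LTok} {C : LTy} (h : LDer l C) :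
    ∀ {X Φ Y : List LTok}, l = X ++ (Φ ++ Y) → Bal Φ → Φ ≠ [] →
      ∃ E, LDer Φ E ∧ LDer (X ++ ty E :: Y) C ∧ ∀ q, E.cnt q ≤ wcnt q Φ ∧
        E.cnt q ≤ wcnt q X + wcnt q Y + C.cnt q := by
  induction h with
  | init i x =>
    intro X Φ Y e hb hne
    cases X with
    | cons t X =>
      simp only [List.cons_append, List.cons.injEq, List.nil_eq, List.append_eq_nil_iff] at e
      exact absurd e.2.2.1 hne
    | nil =>
      cases Φ with
      | nil => exact absurd rfl hne
      | cons t Φ =>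
        simp only [List.nil_append, List.cons_append, List.cons.injEq, List.nil_eq,
          List.append_eq_nil_iff] at e
        obtain ⟨rfl, rfl, rfl⟩ := e
        exact ⟨_, .init i x, .init i x, fun q => by simp only [wcnt_ty, wcnt_nil]; omega⟩
  | @ldivL L Γ R A B C h₁ h₂ ih₁ ih₂ =>
    intro X Φ Y e hb hne
    rcases three_split (t := ty (.ldiv A B)) (L := L ++ Γ) (R := R) (by simpa using e.symm) with
      ⟨X', rfl, rfl⟩ | ⟨Φ₁, Φ₂, rfl, e2, rfl⟩ | ⟨Y₁, rfl, e2⟩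
    · obtain ⟨E, d₁, d₂, c⟩ := ih₂ (X := L ++ ty B :: X') (Φ := Φ) (Y := Y) (by simp) hb hne
      refine ⟨E, d₁, by simpa using LDer.ldivL (L := L) h₁ (by simpa using d₂), fun q => ?_⟩
      have := c q
      simp only [wcnt_append, wcnt_ty, cnt_ldiv] at *; omega
    · rcases List.append_eq_append_iff.1 e2 with ⟨L', rfl, rfl⟩ | ⟨L', rfl, rfl⟩
      · obtain ⟨b₁, b₂, b₃⟩ := h₁.bal.overlap hb
        obtain ⟨F, d₁, d₂, c⟩ := ih₂ (X := L) (Φ := ty B :: Φ₂) (Y := Y) (by simp)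
          (b₃.of_ty.ty B) (by simp)
        -- An empty factor would need the unit as interpolant, which is not available, so empty
        -- pieces are always treated apart.
        by_cases hL : L' = []
        · subst hL
          refine ⟨F, by simpa using LDer.ldivL (L := []) h₁ d₁, by simpa using d₂, fun q => ?_⟩
          have := c q
          simp only [wcnt_append, wcnt_ty, cnt_ldiv, wcnt_nil] at *; omega
        · obtain ⟨E, g₁, g₂, c'⟩ := ih₁ (X := []) (Φ := L') (Y := Φ₁) rfl b₁ hL
          -- The argument `Γ` of the division is split as `L' ++ Φ₁`, with `L'` outside the factor.
          -- With `E` interpolating `L'` in the left premise and `F` interpolating `B` followed by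
          -- `Φ₂` in the right one, the factor yields E\F.
          refine ⟨.ldiv E F, .ldivR (by simpa using LDer.ldivL (L := []) g₂ d₁),
            by simpa using LDer.ldivL g₁ d₂, fun q => ?_⟩
          have := c q
          have := c' q
          simp only [wcnt_append, wcnt_ty, cnt_ldiv, wcnt_nil] at *; omega
      · obtain ⟨E, d₁, d₂, c⟩ := ih₂ (X := X) (Φ := L' ++ ty B :: Φ₂) (Y := Y) (by simp)
          (Bal.replace' (L := L') (M := Γ ++ [ty (.ldiv A B)]) (M' := [ty B]) (R := Φ₂)
            (by simpa using hb) (h₁.bal.append (Bal.single _)) (Bal.single _)) (by simp)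
        refine ⟨E, by simpa using LDer.ldivL (L := L') h₁ d₁, d₂, fun q => ?_⟩
        have := c q
        simp only [wcnt_append, wcnt_ty, cnt_ldiv] at *; omega
    · rcases List.append_eq_append_iff.1 e2 with ⟨X', rfl, rfl⟩ | ⟨L', rfl, e3⟩
      · obtain ⟨E, d₁, d₂, c⟩ := ih₁ rfl hb hne
        refine ⟨E, d₁, by simpa using LDer.ldivL (L := L) d₂ h₂, fun q => ?_⟩
        have := c q
        simp only [wcnt_append, wcnt_ty, cnt_ldiv] at *; omega
      · rcases List.append_eq_append_iff.1 e3 with ⟨L'', rfl, rfl⟩ | ⟨Γ₁, rfl, rfl⟩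
        · obtain ⟨E, d₁, d₂, c⟩ := ih₂ (X := X) (Φ := Φ) (Y := L'' ++ ty B :: R) (by simp) hb hne
          refine ⟨E, d₁, by simpa using LDer.ldivL (L := X ++ ty E :: L'') h₁ (by simpa using d₂),
            fun q => ?_⟩
          have := c q
          simp only [wcnt_append, wcnt_ty, cnt_ldiv] at *; omega
        · obtain ⟨b₁, b₂, b₃⟩ := hb.overlap h₁.bal
          by_cases hL : L' = []
          · subst hL
            obtain ⟨E, d₁, d₂, c⟩ := ih₁ (X := []) (Φ := Γ₁) (Y := Y₁) rfl b₂ (by simpa using hne)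
            refine ⟨E, d₁, by simpa using LDer.ldivL (L := X) d₂ (by simpa using h₂),
              fun q => ?_⟩
            have := c q
            simp only [wcnt_append, wcnt_ty, cnt_ldiv, wcnt_nil] at *; omega
          · obtain ⟨F, g₁, g₂, c'⟩ := ih₂ (X := X) (Φ := L') (Y := ty B :: R) (by simp) b₁ hL
            by_cases hG : Γ₁ = []
            · subst hG
              refine ⟨F, by simpa using g₁,
                ?_, fun q => ?_⟩
              · have := LDer.ldivL (L := X ++ [ty F]) h₁ (by simpa using g₂)
                simpa only [List.append_assoc, List.cons_append, List.nil_append] using this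
              have := c' q
              simp only [wcnt_append, wcnt_ty, cnt_ldiv, wcnt_nil] at *; omega
            · obtain ⟨E, d₁, d₂, c⟩ := ih₁ (X := []) (Φ := Γ₁) (Y := Y₁) rfl b₂ hG
              -- The factor straddles the border between `L` and `Γ`; its two pieces are
              -- interpolated in different premises and joined by a product.
              refine ⟨.prod F E, .prodR g₁ d₁, .prodL
                ?_, fun q => ?_⟩
              · have := LDer.ldivL (L := X ++ [ty F]) d₂ (by simpa using g₂)
                simpa only [List.append_assoc, List.cons_append, List.nil_append] using this
              have := c q
              have := c' q
              simp only [wcnt_append, wcnt_ty, cnt_ldiv, cnt_prod, wcnt_nil] at *; omega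
  | @ldivR Γ A B h ih =>
    intro X Φ Y e hb hne
    obtain ⟨E, d₁, d₂, c⟩ := ih (X := ty A :: X) (Φ := Φ) (Y := Y) (by simp [e]) hb hne
    refine ⟨E, d₁, .ldivR d₂, fun q => ?_⟩
    have := c q
    simp only [wcnt_ty, cnt_ldiv] at *; omega
  | @rdivL L Γ R A B C h₁ h₂ ih₁ ih₂ =>
    intro X Φ Y e hb hne
    rcases three_split (t := ty (.rdiv B A)) (L := L) (R := Γ ++ R) (by simpa using e.symm) with
      ⟨X', rfl, e2⟩ | ⟨Φ₁, Φ₂, rfl, rfl, e2⟩ | ⟨Y₁, rfl, rfl⟩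
    · rcases List.append_eq_append_iff.1 e2 with ⟨L', rfl, e3⟩ | ⟨Γ₂, rfl, e3⟩
      · obtain ⟨E, d₁, d₂, c⟩ := ih₂ (X := L ++ ty B :: L') (Φ := Φ) (Y := Y)
          (by simp [e3]) hb hne
        refine ⟨E, d₁, by simpa using LDer.rdivL (L := L) h₁ (by simpa using d₂), fun q => ?_⟩
        have := c q
        simp only [wcnt_append, wcnt_ty, cnt_rdiv] at *; omega
      · rcases List.append_eq_append_iff.1 e3 with ⟨Γ₃, rfl, rfl⟩ | ⟨R₁, rfl, rfl⟩
        · obtain ⟨E, d₁, d₂, c⟩ := ih₁ rfl hb hne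
          refine ⟨E, d₁, by simpa using LDer.rdivL (L := L) d₂ h₂, fun q => ?_⟩
          have := c q
          simp only [wcnt_append, wcnt_ty, cnt_rdiv] at *; omega
        · obtain ⟨b₁, b₂, b₃⟩ := h₁.bal.overlap hb
          by_cases hR : R₁ = []
          · subst hR
            obtain ⟨E, d₁, d₂, c⟩ := ih₁ (X := X') (Φ := Γ₂) (Y := []) (by simp) b₂
              (by simpa using hne)
            refine ⟨E, by simpa using d₁,
              by simpa using LDer.rdivL (L := L) d₂ (by simpa using h₂), fun q => ?_⟩
            have := c q
            simp only [wcnt_append, wcnt_ty, cnt_rdiv, wcnt_nil] at *; omega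
          · obtain ⟨F, g₁, g₂, c'⟩ := ih₂ (X := L ++ [ty B]) (Φ := R₁) (Y := Y) (by simp) b₃ hR
            by_cases hG : Γ₂ = []
            · subst hG
              refine ⟨F, by simpa using g₁,
                by simpa using LDer.rdivL (L := L) h₁ (by simpa using g₂), fun q => ?_⟩
              have := c' q
              simp only [wcnt_append, wcnt_ty, cnt_rdiv, wcnt_nil] at *; omega
            · obtain ⟨E, d₁, d₂, c⟩ := ih₁ (X := X') (Φ := Γ₂) (Y := []) (by simp) b₂ hG
              refine ⟨.prod E F, .prodR d₁ g₁, .prodL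
                (by simpa using LDer.rdivL (L := L) d₂ (by simpa using g₂)), fun q => ?_⟩
              have := c q
              have := c' q
              simp only [wcnt_append, wcnt_ty, cnt_rdiv, cnt_prod, wcnt_nil] at *; omega
    · rcases List.append_eq_append_iff.1 e2 with ⟨L', rfl, rfl⟩ | ⟨Γ₂, rfl, rfl⟩
      · obtain ⟨E, d₁, d₂, c⟩ := ih₂ (X := X) (Φ := Φ₁ ++ ty B :: L') (Y := Y) (by simp)
          (Bal.replace' (L := Φ₁) (M := ty (.rdiv B A) :: Γ) (M' := [ty B]) (R := L')
            (by simpa using hb) (h₁.bal.ty _) (Bal.single _)) (by simp)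
        refine ⟨E, by simpa using LDer.rdivL (L := Φ₁) h₁ d₁, d₂, fun q => ?_⟩
        have := c q
        simp only [wcnt_append, wcnt_ty, cnt_rdiv] at *; omega
      · obtain ⟨b₁, b₂, b₃⟩ := Bal.overlap (P := Φ₁ ++ [ty (.rdiv B A)]) (by simpa using hb)
          h₁.bal
        have b₁' : Bal (Φ₁ ++ [ty B]) := by
          simpa using Bal.replace' (L := Φ₁) (R := []) (by simpa using b₁)
            (Bal.single (LTy.rdiv B A)) (Bal.single B)
        obtain ⟨F, d₁, d₂, c⟩ := ih₂ (X := X) (Φ := Φ₁ ++ [ty B]) (Y := R) (by simp)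
          b₁' (by simp)
        by_cases hG : Γ₂ = []
        · subst hG
          refine ⟨F, by simpa using LDer.rdivL (L := Φ₁) (R := []) h₁ d₁, by simpa using d₂,
            fun q => ?_⟩
          have := c q
          simp only [wcnt_append, wcnt_ty, cnt_rdiv, wcnt_nil] at *; omega
        · obtain ⟨E, g₁, g₂, c'⟩ := ih₁ (X := Φ₂) (Φ := Γ₂) (Y := []) (by simp) b₃ hG
          refine ⟨.rdiv F E, .rdivR (by simpa using LDer.rdivL (L := Φ₁) (R := []) g₂ d₁),
            by simpa using LDer.rdivL g₁ d₂, fun q => ?_⟩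
          have := c q
          have := c' q
          simp only [wcnt_append, wcnt_ty, cnt_rdiv, wcnt_nil] at *; omega
    · obtain ⟨E, d₁, d₂, c⟩ := ih₂ (X := X) (Φ := Φ) (Y := Y₁ ++ ty B :: R) (by simp) hb hne
      refine ⟨E, d₁, by simpa using LDer.rdivL (L := X ++ ty E :: Y₁) h₁ (by simpa using d₂),
        fun q => ?_⟩
      have := c q
      simp only [wcnt_append, wcnt_ty, cnt_rdiv] at *; omega
  | @rdivR Γ A B h ih =>
    intro X Φ Y e hb hne
    obtain ⟨E, d₁, d₂, c⟩ := ih (X := X) (Φ := Φ) (Y := Y ++ [ty A]) (by simp [e]) hb hne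
    refine ⟨E, d₁, .rdivR (by simpa using d₂), fun q => ?_⟩
    have := c q
    simp only [wcnt_append, wcnt_ty, wcnt_nil, cnt_rdiv] at *; omega
  | @prodL L R A B C h ih =>
    intro X Φ Y e hb hne
    rcases three_split e.symm with ⟨X', rfl, rfl⟩ | ⟨Φ₁, Φ₂, rfl, rfl, rfl⟩ | ⟨Y₁, rfl, rfl⟩
    · obtain ⟨E, d₁, d₂, c⟩ := ih (X := L ++ ty A :: ty B :: X') (Φ := Φ) (Y := Y) (by simp) hb hne
      refine ⟨E, d₁, by simpa using LDer.prodL (L := L) (by simpa using d₂), fun q => ?_⟩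
      have := c q
      simp only [wcnt_append, wcnt_ty, cnt_prod] at *; omega
    · obtain ⟨E, d₁, d₂, c⟩ := ih (X := X) (Φ := Φ₁ ++ ty A :: ty B :: Φ₂) (Y := Y) (by simp)
        (Bal.replace' (L := Φ₁) (M := [ty (.prod A B)]) (M' := [ty A, ty B]) hb (Bal.single _)
          ((Bal.single B).ty A)) (by simp)
      refine ⟨E, .prodL d₁, d₂, fun q => ?_⟩
      have := c q
      simp only [wcnt_append, wcnt_ty, cnt_prod] at *; omega
    · obtain ⟨E, d₁, d₂, c⟩ := ih (X := X) (Φ := Φ) (Y := Y₁ ++ ty A :: ty B :: R) (by simp) hb hne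
      refine ⟨E, d₁, by simpa using LDer.prodL (L := X ++ ty E :: Y₁) (by simpa using d₂),
        fun q => ?_⟩
      have := c q
      simp only [wcnt_append, wcnt_ty, cnt_prod] at *; omega
  | @prodR Γ Δ A B h₁ h₂ ih₁ ih₂ =>
    intro X Φ Y e hb hne
    rcases List.append_eq_append_iff.1 e with ⟨X', rfl, rfl⟩ | ⟨Γ', rfl, e3⟩
    · obtain ⟨E, d₁, d₂, c⟩ := ih₂ rfl hb hne
      refine ⟨E, d₁, by simpa using LDer.prodR h₁ d₂, fun q => ?_⟩
      have := c q
      simp only [wcnt_append, cnt_prod] at *; omega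
    · rcases List.append_eq_append_iff.1 e3 with ⟨Γ₂, rfl, rfl⟩ | ⟨Δ₁, rfl, rfl⟩
      · obtain ⟨E, d₁, d₂, c⟩ := ih₁ rfl hb hne
        refine ⟨E, d₁, by simpa using LDer.prodR d₂ h₂, fun q => ?_⟩
        have := c q
        simp only [wcnt_append, cnt_prod] at *; omega
      · obtain ⟨b₁, b₂, b₃⟩ := h₁.bal.overlap hb
        by_cases hΓ : Γ' = []
        · subst hΓ
          obtain ⟨E, d₁, d₂, c⟩ := ih₂ (X := []) (Φ := Δ₁) (Y := Y) rfl b₃ (by simpa using hne)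
          refine ⟨E, d₁, by simpa using LDer.prodR h₁ d₂, fun q => ?_⟩
          have := c q
          simp only [wcnt_append, cnt_prod, wcnt_nil] at *; omega
        · obtain ⟨E, d₁, d₂, c⟩ := ih₁ (X := X) (Φ := Γ') (Y := []) (by simp) b₂ hΓ
          by_cases hΔ : Δ₁ = []
          · subst hΔ
            refine ⟨E, by simpa using d₁, by simpa using LDer.prodR d₂ h₂, fun q => ?_⟩
            have := c q
            simp only [wcnt_append, cnt_prod, wcnt_nil] at *; omega
          · obtain ⟨F, g₁, g₂, c'⟩ := ih₂ (X := []) (Φ := Δ₁) (Y := Y) rfl b₃ hΔ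
            refine ⟨.prod E F, .prodR d₁ g₁, .prodL (by simpa using LDer.prodR d₂ g₂),
              fun q => ?_⟩
            have := c q
            have := c' q
            simp only [wcnt_append, cnt_prod, wcnt_nil] at *; omega
  | @diaL L R A C j h ih =>
    intro X Φ Y e hb hne
    rcases three_split e.symm with ⟨X', rfl, rfl⟩ | ⟨Φ₁, Φ₂, rfl, rfl, rfl⟩ | ⟨Y₁, rfl, rfl⟩
    · obtain ⟨E, d₁, d₂, c⟩ := ih (X := L ++ op j :: ty A :: cl j :: X') (Φ := Φ) (Y := Y)
        (by simp) hb hne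
      refine ⟨E, d₁, by simpa using LDer.diaL (L := L) (by simpa using d₂), fun q => ?_⟩
      have := c q
      simp only [wcnt_append, wcnt_ty, wcnt_op, wcnt_cl, cnt_dia] at *; omega
    · obtain ⟨E, d₁, d₂, c⟩ := ih (X := X) (Φ := Φ₁ ++ op j :: ty A :: cl j :: Φ₂) (Y := Y)
        (by simp) (Bal.replace' (L := Φ₁) (M := [ty (.dia j A)]) (M' := [op j, ty A, cl j]) hb
          (Bal.single _) ((Bal.single A).bracket j)) (by simp)
      refine ⟨E, .diaL d₁, d₂, fun q => ?_⟩
      have := c q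
      simp only [wcnt_append, wcnt_ty, wcnt_op, wcnt_cl, cnt_dia] at *; omega
    · obtain ⟨E, d₁, d₂, c⟩ := ih (X := X) (Φ := Φ) (Y := Y₁ ++ op j :: ty A :: cl j :: R)
        (by simp) hb hne
      refine ⟨E, d₁, by simpa using LDer.diaL (L := X ++ ty E :: Y₁) (by simpa using d₂),
        fun q => ?_⟩
      have := c q
      simp only [wcnt_append, wcnt_ty, wcnt_op, wcnt_cl, cnt_dia] at *; omega
  | @diaR Γ A j h ih =>
    intro X Φ Y e hb hne
    rcases h.bal.bracket_split e hb hne with ⟨rfl, rfl, rfl⟩ | ⟨X', Y', rfl, rfl, rfl⟩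
    -- The factor is the whole bracket. Its interpolant is ◇ of an interpolant of the content; for
    -- empty content ◇1 takes over.
    · by_cases hΓ : Γ = []
      · subst hΓ
        refine ⟨.unitDia j, .unitDiaR j, .unitDiaL (L := []) (LDer.diaR j h), fun q => ?_⟩
        simp only [List.nil_append, wcnt_op, wcnt_cl, wcnt_nil, cnt_unitDia, cnt_dia]; omega
      · obtain ⟨E, d₁, d₂, c⟩ := ih (X := []) (Φ := Γ) (Y := []) (by simp) h.bal hΓ
        refine ⟨.dia j E, .diaR j d₁, .diaL (L := []) (LDer.diaR j d₂), fun q => ?_⟩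
        have := c q
        simp only [wcnt_append, wcnt_op, wcnt_cl, wcnt_nil, cnt_dia] at *; omega
    · obtain ⟨E, d₁, d₂, c⟩ := ih rfl hb hne
      refine ⟨E, d₁, by simpa using LDer.diaR j d₂, fun q => ?_⟩
      have := c q
      simp only [wcnt_append, wcnt_op, wcnt_cl, wcnt_nil, cnt_dia] at *; omega
  | @boxL L R A C j h ih =>
    intro X Φ Y e hb hne
    rcases three_split (t := ty (.box j A)) (L := L ++ [op j]) (R := cl j :: R)
      (by simpa using e.symm) with
      ⟨X', rfl, e2⟩ | ⟨Φ₁, Φ₂, rfl, e2, e3⟩ | ⟨Y₁, rfl, e2⟩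
    · cases X' with
      | nil =>
        cases Φ with
        | nil => exact absurd rfl hne
        | cons t Φ =>
          simp only [List.nil_append, List.cons_append, List.cons.injEq] at e2
          obtain ⟨rfl, -⟩ := e2
          exact hb.ne_cl.elim
      | cons t X' =>
        simp only [List.cons_append, List.cons.injEq] at e2
        obtain ⟨rfl, rfl⟩ := e2
        obtain ⟨E, d₁, d₂, c⟩ := ih (X := L ++ ty A :: X') (Φ := Φ) (Y := Y) (by simp) hb hne
        refine ⟨E, d₁, by simpa using LDer.boxL (L := L) j (by simpa using d₂), fun q => ?_⟩
        have := c q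
        simp only [wcnt_append, wcnt_ty, wcnt_op, wcnt_cl, wcnt_nil, cnt_box] at *; omega
    · rcases List.eq_nil_or_concat Φ₁ with rfl | ⟨Φ₁', t, rfl⟩
      · cases Φ₂ with
        | nil =>
          simp only [List.append_nil, List.nil_append] at e2 e3
          subst e2 e3
          -- The factor is the boxed type alone, without its bracket: `A` is interpolated in the
          -- premise and the result is boxed with the same label.
          obtain ⟨F, d₁, d₂, c⟩ := ih (X := L) (Φ := [ty A]) (Y := R) (by simp) (Bal.single _)
            (by simp)
          refine ⟨.box j F, .boxR (Bal.single _) (LDer.boxL (L := []) (R := []) j d₁),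
            by simpa using LDer.boxL (L := L) j d₂, fun q => ?_⟩
          have := c q
          simp only [wcnt_append, wcnt_ty, wcnt_op, wcnt_cl, wcnt_nil, cnt_box] at *; omega
        | cons t Φ₂ =>
          simp only [List.cons_append, List.cons.injEq] at e3
          obtain ⟨rfl, rfl⟩ := e3
          exact hb.of_ty.ne_cl.elim
      · obtain ⟨rfl, ht⟩ : L = X ++ Φ₁' ∧ op j = t := by
          have : L ++ [op j] = (X ++ Φ₁') ++ [t] := by simpa using e2
          simpa using List.append_inj' this rfl
        subst ht
        cases Φ₂ with
        | nil =>
          have := Bal.height_suffix (P := Φ₁') (Q := [op j, ty (.box j A)]) (by simpa using hb)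
          simp at this
        | cons t Φ₂ =>
          simp only [List.cons_append, List.cons.injEq] at e3
          obtain ⟨rfl, rfl⟩ := e3
          obtain ⟨E, d₁, d₂, c⟩ := ih (X := X) (Φ := Φ₁' ++ ty A :: Φ₂) (Y := Y) (by simp)
            (Bal.replace' (L := Φ₁') (M := [op j, ty (.box j A), cl j]) (M' := [ty A])
              (by simpa using hb) ((Bal.single (LTy.box j A)).bracket j) (Bal.single _)) (by simp)
          refine ⟨E, by simpa using LDer.boxL j d₁, d₂, fun q => ?_⟩
          have := c q
          simp only [List.concat_eq_append, wcnt_append, wcnt_ty, wcnt_op, wcnt_cl, wcnt_nil,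
            cnt_box] at *
          omega
    · rcases List.eq_nil_or_concat Y₁ with rfl | ⟨Y₁', t, rfl⟩
      · rcases List.eq_nil_or_concat Φ with rfl | ⟨Φ', t, rfl⟩
        · exact absurd rfl hne
        · obtain ⟨-, ht⟩ : L = X ++ Φ' ∧ op j = t := by
            have : L ++ [op j] = (X ++ Φ') ++ [t] := by simpa using e2
            simpa using List.append_inj' this rfl
          subst ht
          have := Bal.height_suffix (P := Φ') (Q := [op j]) (by simpa using hb)
          simp at this
      · obtain ⟨rfl, ht⟩ : L = X ++ (Φ ++ Y₁') ∧ op j = t := by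
          have : L ++ [op j] = (X ++ (Φ ++ Y₁')) ++ [t] := by simpa using e2
          simpa using List.append_inj' this rfl
        subst ht
        obtain ⟨E, d₁, d₂, c⟩ := ih (X := X) (Φ := Φ) (Y := Y₁' ++ ty A :: R) (by simp) hb hne
        refine ⟨E, d₁, by simpa using LDer.boxL (L := X ++ ty E :: Y₁') j (by simpa using d₂),
          fun q => ?_⟩
        have := c q
        simp only [List.concat_eq_append, wcnt_append, wcnt_ty, wcnt_op, wcnt_cl, wcnt_nil,
          cnt_box] at *
        omega
  | @boxR Γ A j hΓ h ih =>
    intro X Φ Y e hb hne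
    obtain ⟨E, d₁, d₂, c⟩ := ih (X := op j :: X) (Φ := Φ) (Y := Y ++ [cl j]) (by simp [e]) hb hne
    subst e
    refine ⟨E, d₁, .boxR (Bal.replace' hΓ hb (M' := [ty E]) (Bal.single _)) (by simpa using d₂),
      fun q => ?_⟩
    have := c q
    simp only [wcnt_append, wcnt_op, wcnt_cl, wcnt_nil, cnt_box] at *; omega
  | @unitDiaL L R C j h ih =>
    intro X Φ Y e hb hne
    rcases three_split e.symm with ⟨X', rfl, rfl⟩ | ⟨Φ₁, Φ₂, rfl, rfl, rfl⟩ | ⟨Y₁, rfl, rfl⟩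
    · obtain ⟨E, d₁, d₂, c⟩ := ih (X := L ++ op j :: cl j :: X') (Φ := Φ) (Y := Y)
        (by simp) hb hne
      refine ⟨E, d₁, by simpa using LDer.unitDiaL (L := L) (by simpa using d₂), fun q => ?_⟩
      have := c q
      simp only [wcnt_append, wcnt_ty, wcnt_op, wcnt_cl, cnt_unitDia] at *; omega
    · obtain ⟨E, d₁, d₂, c⟩ := ih (X := X) (Φ := Φ₁ ++ op j :: cl j :: Φ₂) (Y := Y)
        (by simp) (Bal.replace' (L := Φ₁) (M := [ty (.unitDia j)]) (M' := [op j, cl j]) hb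
          (Bal.single _) (Bal.nil.bracket j)) (by simp)
      refine ⟨E, .unitDiaL d₁, d₂, fun q => ?_⟩
      have := c q
      simp only [wcnt_append, wcnt_ty, wcnt_op, wcnt_cl, cnt_unitDia] at *; omega
    · obtain ⟨E, d₁, d₂, c⟩ := ih (X := X) (Φ := Φ) (Y := Y₁ ++ op j :: cl j :: R)
        (by simp) hb hne
      refine ⟨E, d₁, by simpa using LDer.unitDiaL (L := X ++ ty E :: Y₁) (by simpa using d₂),
        fun q => ?_⟩
      have := c q
      simp only [wcnt_append, wcnt_ty, wcnt_op, wcnt_cl, cnt_unitDia] at *; omega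
  | unitDiaR j =>
    intro X Φ Y e hb hne
    rcases Bal.nil.bracket_split (j := j) e hb hne with ⟨rfl, rfl, rfl⟩ | ⟨X', Y', rfl, rfl, e3⟩
    · refine ⟨.unitDia j, .unitDiaR j, .unitDiaL (L := []) (.unitDiaR j), fun q => ?_⟩
      simp only [List.nil_append, wcnt_op, wcnt_cl, wcnt_nil, cnt_unitDia]; omega
    · have := (List.append_eq_nil_iff.1 e3.symm).2
      exact absurd (List.append_eq_nil_iff.1 this).1 hne

-- Group valuations and noncrossing words

section Evaluation

variable {G : Type} [Group G] {v : Letter → G}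

theorem prod_map_reverse (hv : ∀ x, v x * v x = 1) (w : List Letter) :
    (w.reverse.map v).prod = ((w.map v).prod)⁻¹ := by
  induction w with
  | nil => simp
  | cons x w ih =>
    have : (v x)⁻¹ = v x := inv_eq_of_mul_eq_one_left (hv x)
    rw [List.reverse_cons, List.map_append, List.prod_append, ih]
    simp [this]

/-- Sequents become equations in a group. Reversal of words is inversion because letters are
involutions; for the same reason a bracket around a box with the same label cancels, which is what
the box rules require. -/
theorem LDer.prod_eq (hv : ∀ x, v x * v x = 1) {l : List LTok} {C : LTy} (h : LDer l C) :
    ((words l).map v).prod = (C.word.map v).prod := by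
  have hc : ∀ x g, v x * (v x * g) = g := fun x g => by rw [← mul_assoc, hv, one_mul]
  have hi : ∀ x, (v x)⁻¹ = v x := fun x => inv_eq_of_mul_eq_one_left (hv x)
  induction h with
  | init i x => simp [words, tokWord, LTy.word]
  | ldivL _ _ ih₁ ih₂ =>
    simp only [words_append, words_cons, tokWord, LTy.word, List.map_append, List.prod_append,
      prod_map_reverse hv, ih₁] at *
    rw [← ih₂]; group
  | ldivR _ ih =>
    simp only [words_cons, tokWord, LTy.word, List.map_append, List.prod_append,
      prod_map_reverse hv] at *
    rw [← ih]; group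
  | rdivL _ _ ih₁ ih₂ =>
    simp only [words_append, words_cons, tokWord, LTy.word, List.map_append, List.prod_append,
      prod_map_reverse hv, ih₁] at *
    rw [← ih₂]; group
  | rdivR _ ih =>
    simp only [words_append, words_cons, words_nil, tokWord, LTy.word, List.map_append,
      List.prod_append, prod_map_reverse hv, List.append_nil] at *
    rw [← ih]; group
  | prodL _ ih =>
    simp only [words_append, words_cons, tokWord, LTy.word, List.append_assoc] at *
    exact ih
  | prodR _ _ ih₁ ih₂ =>
    simp only [words_append, LTy.word, List.map_append, List.prod_append, ih₁, ih₂]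
  | diaL _ ih =>
    simp only [words_append, words_cons, tokWord, LTy.word, List.append_assoc] at *
    exact ih
  | diaR j _ ih =>
    simp only [words_append, words_cons, words_nil, tokWord, LTy.word, List.map_append,
      List.prod_append, List.append_nil, ih]
  | boxL j _ ih =>
    simp only [words_append, words_cons, tokWord, LTy.word, List.map_append, List.prod_append,
      List.map_cons, List.map_nil, List.prod_cons, List.prod_nil, mul_one, mul_assoc, hc] at *
    exact ih
  | boxR _ _ ih =>
    simp only [words_append, words_cons, words_nil, tokWord, LTy.word, List.map_append,
      List.prod_append, List.append_nil, List.map_cons, List.map_nil, List.prod_cons,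
      List.prod_nil, mul_one] at *
    simp only [← ih, mul_assoc, hc, hv, mul_one]
  | unitDiaL _ ih =>
    simp only [words_append, words_cons, tokWord, LTy.word, List.append_assoc] at *
    exact ih
  | unitDiaR j => simp [words, tokWord, LTy.word]

end Evaluation

/-- Words in which every letter occurs at most twice and which are trivial under every
valuation of the letters by involutions. -/
def Closed (W : List Letter) : Prop :=
  (∀ q, W.count q ≤ 2) ∧
    ∀ v : Letter → Equiv.Perm (Fin 3), (∀ x, v x * v x = 1) → (W.map v).prod = 1

namespace Closed

theorem rotate {U V : List Letter} (h : Closed (U ++ V)) : Closed (V ++ U) := by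
  refine ⟨fun q => ?_, fun v hv => ?_⟩
  · have := h.1 q
    simp only [List.count_append] at *; omega
  · have := h.2 v hv
    simp only [List.map_append, List.prod_append] at *
    exact mul_eq_one_comm.1 this

/-- Send `q` to a transposition and every other letter to 1. -/
theorem even {W : List Letter} (h : Closed W) (q : Letter) : W.count q % 2 = 0 := by
  have hq := h.1 q
  have := h.2 (fun x => if x = q then Equiv.swap 0 1 else 1) (fun x => by
    split_ifs
    · exact Equiv.swap_mul_self 0 1
    · simp)
  rw [List.prod_map_eq_pow_single q _ (fun a ha _ => by simp [ha])] at this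
  simp only [if_true] at this
  by_contra hodd
  have h1 : W.count q = 1 := by omega
  rw [h1] at this
  exact absurd this (by decide)

/-- Send `p` and `q` to two noncommuting transpositions and all else to 1: a pattern p q p q would
evaluate to the square of a 3-cycle, which is not 1. -/
theorem not_crossing {I J K L : List Letter} (h : Closed (I ++ (J ++ (K ++ L)))) {p q : Letter}
    (hI : I.count p % 2 = 1) (hK : K.count p % 2 = 1) (hJ : J.count q % 2 = 1)
    (hL : L.count q % 2 = 1) : False := by
  have hp := h.1 p
  have hq := h.1 q
  simp only [List.count_append] at hp hq
  have hpq : q ≠ p := by rintro rfl; omega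
  have := h.2 (fun x => if x = p then Equiv.swap 0 1 else if x = q then Equiv.swap 1 2 else 1)
    (fun x => by
      split_ifs
      · exact Equiv.swap_mul_self 0 1
      · exact Equiv.swap_mul_self 1 2
      · simp)
  have key : ∀ w : List Letter, w.count q = 0 ∨ w.count p = 0 →
      (w.map (fun x => if x = p then Equiv.swap 0 1 else if x = q then Equiv.swap 1 2 else 1)).prod
        = (Equiv.swap 0 1 : Equiv.Perm (Fin 3)) ^ w.count p * (Equiv.swap 1 2) ^ w.count q := by
    intro w hw
    rcases hw with hw | hw
    · rw [List.prod_map_eq_pow_single p]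
      · simp [hw]
      · intro x hx hxw
        have : x ≠ q := by rintro rfl; exact List.count_eq_zero.1 hw hxw
        simp [hx, this]
    · rw [List.prod_map_eq_pow_single q]
      · simp [hw, hpq]
      · intro x hx hxw
        have : x ≠ p := by rintro rfl; exact List.count_eq_zero.1 hw hxw
        simp [hx, this]
  simp only [List.map_append, List.prod_append] at this
  rw [key I (by omega), key J (by omega), key K (by omega), key L (by omega),
    show I.count p = 1 by omega, show J.count p = 0 by omega, show K.count p = 1 by omega,
    show L.count p = 0 by omega, show I.count q = 0 by omega, show J.count q = 1 by omega,
    show K.count q = 0 by omega, show L.count q = 1 by omega] at this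
  exact absurd this (by decide)

/-- A letter with odd count between the two occurrences of `a` would have its other occurrence
outside, and so cross `a`. -/
theorem even_between {P Q R : List Letter} {a : Letter} (h : Closed (P ++ a :: (Q ++ a :: R)))
    (q : Letter) : Q.count q % 2 = 0 := by
  by_contra hq
  have h' : Closed ([a] ++ (Q ++ ([a] ++ (R ++ P)))) := by
    simpa using h.rotate
  have h1 := h'.1 q
  have h2 := h'.even q
  have h3 := h'.1 a
  simp only [List.count_append] at h1 h2 h3
  by_cases ha : q = a
  · subst ha
    simp at h3; omega
  · have : [a].count q = 0 := by simp [Ne.symm ha]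
    exact h'.not_crossing (p := a) (q := q) (by simp) (by simp) (by omega)
      (by simp only [List.count_append]; omega)

theorem exists_split_pair {Z : List Letter} {a b : Letter} (hab : a ≠ b) (ha : a ∈ Z)
    (hb : b ∈ Z) : (∃ p x y, Z = p ++ a :: (x ++ b :: y)) ∨ ∃ p x y, Z = p ++ b :: (x ++ a :: y) := by
  obtain ⟨p, r, rfl⟩ := List.append_of_mem ha
  rcases List.mem_append.1 hb with hb | hb
  · obtain ⟨p', x, rfl⟩ := List.append_of_mem hb
    exact .inr ⟨p', x, r, by simp⟩
  · rcases List.mem_cons.1 hb with hb | hb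
    · exact absurd hb.symm hab
    · obtain ⟨x, y, rfl⟩ := List.append_of_mem hb
      exact .inl ⟨p, x, y, rfl⟩

/-- Here `a F b` is a bracket with its content and `Z` the word of a type outside it that repeats
both bracket letters. Noncrossing forces the opposite order `b x a` inside `Z`, and pairs every
letter leaving `F` with one in `x`. -/
theorem outside {F U Z V : List Letter} {a b : Letter} (hab : a ≠ b)
    (h : Closed (a :: (F ++ b :: (U ++ (Z ++ V))))) (ha : a ∈ Z) (hb : b ∈ Z) :
    ∃ x : List Letter, x.length + 2 ≤ Z.length ∧ ∀ q, F.count q % 2 = 1 → q ∈ x := by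
  rcases exists_split_pair hab ha hb with ⟨p, x, y, rfl⟩ | ⟨p, x, y, rfl⟩
  · exfalso
    have e1 := Closed.even_between (P := []) (Q := F ++ b :: (U ++ p)) (R := x ++ b :: (y ++ V))
      (a := a) (by simpa using h) b
    have e2 := h.1 b
    simp only [List.count_append, List.count_cons_self, List.count_cons_of_ne hab] at e1 e2
    omega
  · refine ⟨x, by simp; omega, fun q hq => ?_⟩
    have e1 := Closed.even_between (P := []) (Q := F ++ b :: (U ++ (p ++ b :: x))) (R := y ++ V)
      (a := a) (by simpa using h) q
    have e2 := Closed.even_between (P := a :: F) (Q := U ++ p) (R := x ++ a :: (y ++ V))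
      (a := b) (by simpa using h) q
    simp only [List.count_append, List.count_cons] at e1 e2
    exact List.count_pos_iff.1 (by omega)

/-- Now the type repeating the bracket letters lies within the bracket. They occur there in the
order `a x b`; the stretches from `a` to `a` and from `b` to `b` are closed in themselves, so
whatever leaves the bracket comes from `x`. -/
theorem inside {F₁ Z F₂ V : List Letter} {a b : Letter} (hab : a ≠ b)
    (h : Closed (a :: ((F₁ ++ (Z ++ F₂)) ++ b :: V))) (ha : a ∈ Z) (hb : b ∈ Z) :
    ∃ x : List Letter, x.length + 2 ≤ Z.length ∧
      ∀ q, (a :: ((F₁ ++ (Z ++ F₂)) ++ [b])).count q % 2 = 1 → q ∈ x := by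
  rcases exists_split_pair hab ha hb with ⟨p, x, y, rfl⟩ | ⟨p, x, y, rfl⟩
  · refine ⟨x, by simp; omega, fun q hq => ?_⟩
    have e1 := Closed.even_between (P := []) (Q := F₁ ++ p) (R := x ++ b :: (y ++ F₂ ++ b :: V))
      (a := a) (by simpa using h) q
    have e2 := Closed.even_between (P := a :: (F₁ ++ (p ++ a :: x))) (Q := y ++ F₂) (R := V)
      (a := b) (by simpa using h) q
    simp only [List.count_append, List.count_cons, List.count_nil] at e1 e2 hq
    exact List.count_pos_iff.1 (by omega)
  · exfalso
    have e1 := Closed.even_between (P := []) (Q := F₁ ++ (p ++ b :: x)) (R := y ++ F₂ ++ b :: V)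
      (a := a) (by simpa using h) b
    have e2 := h.1 b
    simp only [List.count_append, List.count_cons_self, List.count_cons_of_ne hab] at e1 e2
    omega

/-- The number of letters of `S` occurring an odd number of times in `w`. -/
def _root_.LambekBrackets.crossing (S : Finset Letter) (w : List Letter) : ℕ :=
  ∑ q ∈ S, w.count q % 2

/-- The four-point inequality of tree metrics. -/
theorem four_point (S : Finset Letter) {I J K L : List Letter}
    (h : Closed (I ++ (J ++ (K ++ L)))) :
    crossing S (I ++ J) + crossing S (J ++ K) ≤ crossing S I + crossing S K ∨
    crossing S (I ++ J) + crossing S (J ++ K) ≤ crossing S J + crossing S L := by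
  simp only [crossing, ← Finset.sum_add_distrib, List.count_append]
  have he := h.even
  simp only [List.count_append] at he
  -- A letter joining `I` to `K` excludes letters joining `J` to `L`. Those two kinds are the only
  -- ones that can violate the right and the left inequality, respectively.
  by_cases hp : ∃ p, I.count p % 2 = 1 ∧ K.count p % 2 = 1 ∧ J.count p % 2 = 0
  · obtain ⟨p, hp1, hp2, hp3⟩ := hp
    left
    refine Finset.sum_le_sum fun q _ => ?_
    have := he q
    by_contra hlt
    exact h.not_crossing hp1 hp2 (q := q) (by omega) (by omega)
  · right
    refine Finset.sum_le_sum fun q _ => ?_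
    have := he q
    by_contra hlt
    exact hp ⟨q, by omega, by omega, by omega⟩

end Closed

-- Thin sequents: bounds on interpolants

/-- A derivable labelled sequent in which every letter occurs at most twice. -/
structure Thin (l : List LTok) (C : LTy) : Prop where
  der : LDer l C
  le_two : ∀ q, wcnt q l + C.cnt q ≤ 2

theorem Thin.closed {l : List LTok} {C : LTy} (h : Thin l C) :
    Closed (words l ++ C.word.reverse) := by
  refine ⟨fun q => ?_, fun v hv => ?_⟩
  · rw [List.count_append, List.count_reverse]
    exact h.le_two q
  · rw [List.map_append, List.prod_append, prod_map_reverse hv, h.der.prod_eq hv, mul_inv_cancel]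

/-- The opening brackets among the tokens. -/
def opWord : LTok → List Letter
  | .ty _ => []
  | .op j => [.opn j]
  | .cl _ => []

/-- The number of occurrences of an opening bracket with label `j`. -/
def opCnt (j : ℕ) (l : List LTok) : ℕ := (l.flatMap opWord).count (.opn j)

section

variable (j : ℕ)

theorem opCnt_nil : opCnt j [] = 0 := rfl

theorem opCnt_append (l l' : List LTok) : opCnt j (l ++ l') = opCnt j l + opCnt j l' := by
  simp [opCnt]

theorem opCnt_ty (A : LTy) (l : List LTok) : opCnt j (.ty A :: l) = opCnt j l := by
  simp [opCnt, opWord]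

theorem opCnt_op (k : ℕ) (l : List LTok) :
    opCnt j (.op k :: l) = [Letter.opn k].count (.opn j) + opCnt j l := by
  rw [opCnt, List.flatMap_cons, List.count_append]; rfl

theorem opCnt_cl (k : ℕ) (l : List LTok) : opCnt j (.cl k :: l) = opCnt j l := by
  simp [opCnt, opWord]

end

/-- Each rule creating a bracket token also puts the same letter into a type, so at most half of the
occurrences are tokens. In a thin sequent a bracket label therefore belongs to at most one bracket
token pair. -/
theorem LDer.two_mul_opCnt_le {l : List LTok} {C : LTy} (h : LDer l C) (j : ℕ) :
    2 * opCnt j l ≤ wcnt (.opn j) l + C.cnt (.opn j) := by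
  induction h <;>
  simp only [opCnt_nil, opCnt_append, opCnt_ty, opCnt_op, opCnt_cl, wcnt_nil, wcnt_append, wcnt_ty,
    wcnt_op, wcnt_cl, cnt_unitDia, cnt_ldiv, cnt_rdiv, cnt_prod, cnt_dia, cnt_box] at * <;> omega

theorem exists_ty_of_mem_words {j : ℕ} {l : List LTok} (h : .opn j ∈ words l)
    (h0 : opCnt j l = 0) : ∃ A l₁ l₂, l = l₁ ++ ty A :: l₂ ∧ .opn j ∈ A.word := by
  induction l with
  | nil => simp [words_nil] at h
  | cons t l ih =>
    have step : opCnt j l = 0 → Letter.opn j ∈ words l →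
        ∃ A l₁ l₂, t :: l = l₁ ++ ty A :: l₂ ∧ .opn j ∈ A.word := by
      intro h1 h2
      obtain ⟨A, l₁, l₂, rfl, hA⟩ := ih h2 h1
      exact ⟨A, t :: l₁, l₂, rfl, hA⟩
    rw [words_cons, List.mem_append] at h
    cases t with
    | ty A =>
      rcases h with h | h
      · exact ⟨A, [], l, rfl, h⟩
      · exact step (by simpa only [opCnt_ty] using h0) h
    | op k =>
      simp only [opCnt_op] at h0
      rcases h with h | h
      · simp only [tokWord] at h
        have := List.count_pos_iff.2 h
        omega
      · exact step (by omega) h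
    | cl k =>
      rcases h with h | h
      · simp [tokWord] at h
      · exact step (by simpa only [opCnt_cl] using h0) h

theorem LTy.length_word_le {E : LTy} {x : List Letter} (h1 : ∀ q, E.cnt q ≤ 1)
    (h2 : ∀ q, 0 < E.cnt q → q ∈ x) : E.word.length ≤ x.length :=
  (List.Nodup.subperm (List.nodup_iff_count_le_one.2 h1)
    (fun q hq => h2 q (List.count_pos_iff.2 hq))).length_le

/-- Here `w` is the word of the factor and `n` counts occurrences outside it. A letter of `E` occurs
on both sides, hence exactly once on each, and so crosses the border. -/
theorem LTy.length_word_le_crossing {E : LTy} {S : Finset Letter} {w : List Letter} {n : Letter → ℕ}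
    (hS : ∀ q ∈ w, q ∈ S) (h1 : ∀ q, E.cnt q ≤ w.count q ∧ E.cnt q ≤ n q)
    (h2 : ∀ q, w.count q + n q ≤ 2) : E.word.length ≤ crossing S w := by
  have hE : ∀ q ∈ E.word, q ∈ S := fun q hq => hS q (List.count_pos_iff.1
    (lt_of_lt_of_le (List.count_pos_iff.2 hq) (h1 q).1))
  have : E.word.length = ∑ q ∈ S, E.cnt q := by
    have := Multiset.sum_count_eq_card (s := S) (m := (E.word : Multiset Letter)) (by simpa using hE)
    simpa [LTy.cnt] using this.symm
  rw [this]
  refine Finset.sum_le_sum fun q _ => ?_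
  have := h1 q
  have := h2 q
  omega

/-- A bracket of a thin sequent can be removed, either inwards or outwards. -/
theorem Thin.bracket {X Φ Y : List LTok} {C : LTy} {j m : ℕ}
    (h : Thin (X ++ (op j :: (Φ ++ cl j :: Y))) C)
    (hm : ∀ A, ty A ∈ X ++ (op j :: (Φ ++ cl j :: Y)) → A.word.length ≤ m)
    (hC : C.word.length ≤ m) :
    (Φ ≠ [] ∧ ∀ E : LTy, (∀ q, E.cnt q ≤ wcnt q (op j :: (Φ ++ [cl j])) ∧
        E.cnt q ≤ wcnt q X + wcnt q Y + C.cnt q) → E.word.length + 2 ≤ m) ∨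
    (2 ≤ m ∧ ∀ E : LTy, (∀ q, E.cnt q ≤ wcnt q Φ ∧
        E.cnt q ≤ wcnt q (X ++ [op j]) + wcnt q (cl j :: Y) + C.cnt q) →
          E.word.length + 2 ≤ m) := by
  have hcl : Closed (.opn j :: (words Φ ++ .cls j :: (words Y ++ (C.word.reverse ++ words X)))) := by
    have := h.closed
    simp only [words_append, words_cons, tokWord, List.append_assoc] at this
    simpa using this.rotate
  have h2 := h.le_two
  have hop := h.der.two_mul_opCnt_le j
  have hj := h2 (.opn j)
  -- The opening bracket shown is the only token with this label; by parity the letter occurs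
  -- exactly once more, inside a type of the antecedent or in `C`.
  have h0 : opCnt j X = 0 ∧ opCnt j Φ = 0 ∧ opCnt j Y = 0 := by
    simp only [opCnt_append, opCnt_op, opCnt_cl, List.count_singleton_self] at hop
    omega
  have hne : Letter.opn j ≠ Letter.cls j := by simp
  have hpair : ∀ A : LTy, .opn j ∈ A.word → .cls j ∈ A.word := fun A hA =>
    List.count_pos_iff.1 (lt_of_lt_of_eq (List.count_pos_iff.2 hA) (A.cnt_opn_eq_cnt_cls j))
  have hev := hcl.even (.opn j)
  simp only [List.count_cons_self, List.count_append, List.count_cons_of_ne hne.symm] at hev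
  simp only [wcnt_append, wcnt_op, wcnt_cl, wcnt_nil] at h2 ⊢
  -- Common end of the cases where the second occurrence lies in a type outside the bracket; `Z` is
  -- the word of that type, reversed if it is the succedent.
  have finish : ∀ (U Z V : List Letter),
      words Y ++ (C.word.reverse ++ words X) = U ++ (Z ++ V) → .opn j ∈ Z → .cls j ∈ Z →
      Z.length ≤ m → (2 ≤ m ∧ ∀ E : LTy, (∀ q, E.cnt q ≤ wcnt q Φ ∧
        E.cnt q ≤ wcnt q X + ([Letter.opn j].count q + 0) + ([Letter.cls j].count q + wcnt q Y) +
          C.cnt q) → E.word.length + 2 ≤ m) := by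
    intro U Z V e ha hb hZ
    rw [e] at hcl
    obtain ⟨x, hx, hq⟩ := hcl.outside hne ha hb
    refine ⟨by omega, fun E hE => ?_⟩
    have := LTy.length_word_le (E := E) (x := x)
      (fun q => by have := hE q; have := h2 q; omega)
      (fun q hpos => hq q (by
        have := hE q; have := h2 q
        change wcnt q Φ % 2 = 1
        omega))
    omega
  by_cases hΦ : .opn j ∈ words Φ
  · left
    obtain ⟨A, l₁, l₂, rfl, hA⟩ := exists_ty_of_mem_words hΦ h0.2.1
    refine ⟨by simp, fun E hE => ?_⟩
    have hcl' := hcl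
    simp only [words_append, words_cons, tokWord] at hcl'
    obtain ⟨x, hx, hq⟩ := hcl'.inside hne hA (hpair A hA)
    have hA' := hm A (by simp)
    have := LTy.length_word_le (E := E) (x := x)
      (fun q => by have := hE q; have := h2 q; omega)
      (fun q hpos => hq q (by
        have := hE q; have := h2 q
        have e : (Letter.opn j :: (words l₁ ++ (A.word ++ words l₂) ++ [Letter.cls j])).count q
          = [Letter.opn j].count q + (wcnt q (l₁ ++ ty A :: l₂) + ([Letter.cls j].count q + 0)) := by
          rw [← List.singleton_append]
          simp only [List.count_append, wcnt, words_append, words_cons, tokWord]; omega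
        rw [e]
        omega))
    omega
  · right
    have hΦ0 : (words Φ).count (.opn j) = 0 := List.count_eq_zero.2 hΦ
    by_cases hY : .opn j ∈ words Y
    · obtain ⟨A, l₁, l₂, rfl, hA⟩ := exists_ty_of_mem_words hY h0.2.2
      exact finish (words l₁) A.word (words l₂ ++ (C.word.reverse ++ words X))
        (by simp [words_append, words_cons, tokWord]) hA (hpair A hA) (hm A (by simp))
    · by_cases hX : .opn j ∈ words X
      · obtain ⟨A, l₁, l₂, rfl, hA⟩ := exists_ty_of_mem_words hX h0.1
        exact finish (words Y ++ (C.word.reverse ++ words l₁)) A.word (words l₂)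
          (by simp [words_append, words_cons, tokWord]) hA (hpair A hA) (hm A (by simp))
      · have hY0 : (words Y).count (.opn j) = 0 := List.count_eq_zero.2 hY
        have hX0 : (words X).count (.opn j) = 0 := List.count_eq_zero.2 hX
        have hC' : .opn j ∈ C.word := List.mem_reverse.1 (List.count_pos_iff.1 (by omega))
        exact finish (words Y) C.word.reverse (words X) rfl (by simpa using hC')
          (by simpa using hpair C hC') (by simpa using hC)

theorem crossing_le_length {S : Finset Letter} {w : List Letter} (hS : ∀ q ∈ w, q ∈ S) :
    crossing S w ≤ w.length := by
  have := Multiset.sum_count_eq_card (s := S) (m := (w : Multiset Letter)) (by simpa using hS)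
  simp only [Multiset.coe_count, Multiset.coe_card] at this
  rw [← this]
  exact Finset.sum_le_sum fun q _ => Nat.mod_le _ _

/-- Pentus's lemma: in a long bracket-free thin sequent two neighbours can be merged. -/
theorem Thin.exists_pair {m : ℕ} {As : List LTy} {C : LTy} (h : Thin (As.map ty) C)
    (hm : ∀ A ∈ As, A.word.length ≤ m) (hC : C.word.length ≤ m) (h2' : 2 ≤ As.length) :
    ∃ X A B Y, As = X ++ A :: B :: Y ∧ ∀ E : LTy, (∀ q, E.cnt q ≤ wcnt q [ty A, ty B] ∧
      E.cnt q ≤ wcnt q (X.map ty) + wcnt q (Y.map ty) + C.cnt q) → E.word.length ≤ m := by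
  by_contra hcon
  push Not at hcon
  have hcl := h.closed
  set S := (words (As.map ty) ++ C.word.reverse).toFinset with hSdef
  have hS : ∀ q, q ∈ words (As.map ty) ∨ q ∈ C.word → q ∈ S := fun q hq => by
    rw [hSdef, List.mem_toFinset, List.mem_append, List.mem_reverse]
    exact hq
  have h2 := h.le_two
  -- If no two neighbours can be merged, every pair of neighbours has more than `m` letters crossing
  -- its border.
  have pair : ∀ X A B Y, As = X ++ A :: B :: Y → m < crossing S (A.word ++ B.word) := by
    intro X A B Y e
    obtain ⟨E, hE, hlt⟩ := hcon X A B Y e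
    subst e
    refine hlt.trans_le (LTy.length_word_le_crossing
      (n := fun q => wcnt q (X.map ty) + wcnt q (Y.map ty) + C.cnt q)
      (fun q hq => hS q (.inl ?_)) (fun q => ?_) fun q => ?_)
    · simp only [List.map_append, List.map_cons, words_append, words_cons, tokWord, List.mem_append]
        at hq ⊢
      tauto
    · have := hE q
      simp only [wcnt_ty, wcnt_nil] at this
      simp only [List.count_append]
      simp only [LTy.cnt] at this ⊢
      omega
    · have := h2 q
      simp only [List.map_append, List.map_cons, wcnt_append, wcnt_ty] at this
      simp only [List.count_append]
      simp only [LTy.cnt] at this ⊢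
      omega
  have single : ∀ A ∈ As, crossing S A.word ≤ m := by
    intro A hA
    refine (crossing_le_length fun q hq => hS q (.inl ?_)).trans (hm A hA)
    exact List.mem_flatMap.2 ⟨ty A, List.mem_map_of_mem hA, hq⟩
  have compl : ∀ U V : List Letter, U ++ V = words (As.map ty) ++ C.word.reverse →
      crossing S U = crossing S V := by
    intro U V e
    refine Finset.sum_congr rfl fun q _ => ?_
    have := hcl.even q
    rw [← e, List.count_append] at this
    omega
  -- Once the crossing number of prefixes exceeds `m` without having decreased, it keeps growing. At
  -- the full antecedent this contradicts the bound for `C`.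
  have grow : ∀ (R X : List LTy) (A : LTy), As = X ++ A :: R →
      crossing S (words (X.map ty)) ≤ crossing S (words (X.map ty) ++ A.word) →
      m < crossing S (words (X.map ty) ++ A.word) → False := by
    intro R
    induction R with
    | nil =>
      intro X A e _ hlt
      have e1 : words (As.map ty) = words (X.map ty) ++ A.word := by
        simp [e, words_append, words_cons, words_nil, tokWord]
      rw [← e1, compl _ _ rfl] at hlt
      have := crossing_le_length (S := S) (w := C.word.reverse)
        (fun q hq => hS q (.inr (List.mem_reverse.1 hq)))
      rw [List.length_reverse] at this
      omega
    | cons D R ih =>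
      intro X A e hle hlt
      have e1 : words (As.map ty) ++ C.word.reverse = words (X.map ty) ++ (A.word ++
          (D.word ++ (words (R.map ty) ++ C.word.reverse))) := by
        simp [e, words_append, words_cons, tokWord]
      have hp := pair X A D R e
      have hA := single A (by simp [e])
      have hD := single D (by simp [e])
      have hcomp := compl (words (X.map ty) ++ (A.word ++ D.word))
        (words (R.map ty) ++ C.word.reverse) (by rw [e1]; simp)
      have e2 : words ((X ++ [A]).map ty) = words (X.map ty) ++ A.word := by
        simp [words_append, words_cons, words_nil, tokWord]
      rw [e1] at hcl
      -- Applied to the prefix, `A`, `D` and the rest. The first alternative fails, since the prefix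
      -- did not shrink on adding `A` and the pair exceeds `m`, which bounds `D`; the second gives
      -- strict growth on adding `D`.
      have := hcl.four_point S
      refine ih (X ++ [A]) D (by simp [e]) ?_ ?_ <;> rw [e2, List.append_assoc] <;> omega
  obtain ⟨A₁, A₂, R, hAs⟩ : ∃ A₁ A₂ R, As = A₁ :: A₂ :: R := by
    match As, h2' with
    | A₁ :: A₂ :: R, _ => exact ⟨A₁, A₂, R, rfl⟩
  have h1 := single A₁ (by simp [hAs])
  have hp := pair [] A₁ A₂ R hAs
  have e : words ([A₁].map ty) = A₁.word := by simp [words_cons, words_nil, tokWord]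
  exact grow R [A₁] A₂ hAs (by rw [e]; omega) (by rw [e]; omega)

-- Hedges as token strings

abbrev ETok : Type := Tok Ty Unit

mutual
/-- The linear notation of a type tree. -/
def Tree.flat : Tree → List ETok
  | .leaf A => [.ty A]
  | .node ts => .op () :: (flat ts ++ [.cl ()])
/-- The linear notation of a type hedge. -/
def flat : List Tree → List ETok
  | [] => []
  | t :: ts => t.flat ++ flat ts
end

theorem flat_nil : flat [] = [] := by rw [flat]

theorem flat_leaf (A : Ty) (ts : Hedge) : flat (.leaf A :: ts) = ty A :: flat ts := by
  rw [flat, Tree.flat]; rfl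

theorem flat_node (ts ts' : Hedge) :
    flat (.node ts :: ts') = op () :: (flat ts ++ cl () :: flat ts') := by
  rw [flat, Tree.flat]; simp

theorem flat_append (ts ts' : Hedge) : flat (ts ++ ts') = flat ts ++ flat ts' := by
  induction ts with
  | nil => simp [flat_nil]
  | cons t ts ih => rw [List.cons_append, flat, ih, flat, List.append_assoc]

theorem flat_map_leaf (As : List Ty) : flat (As.map Tree.leaf) = As.map ty := by
  induction As with
  | nil => exact flat_nil
  | cons A As ih => rw [List.map_cons, flat_leaf, ih, List.map_cons]

/-- Induction on hedges. -/
theorem Hedge.rec' {P : Hedge → Prop} (nil : P []) (leaf : ∀ A ts, P ts → P (.leaf A :: ts))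
    (node : ∀ ts ts', P ts → P ts' → P (.node ts :: ts')) : ∀ Γ, P Γ
  | [] => nil
  | .leaf A :: ts => leaf A ts (Hedge.rec' nil leaf node ts)
  | .node ts :: ts' => node ts ts' (Hedge.rec' nil leaf node ts) (Hedge.rec' nil leaf node ts')

theorem bal_flat (Γ : Hedge) : Bal (flat Γ) := by
  induction Γ using Hedge.rec' with
  | nil => rw [flat_nil]; exact .nil
  | leaf A ts ih => rw [flat_leaf]; exact ih.ty A
  | node ts ts' ih ih' => rw [flat_node]; exact ih.br () ih'

/-- The closing bracket acts as an end marker and makes the notation uniquely readable. -/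
theorem flat_cancel (Γ : Hedge) : ∀ (Δ : Hedge) (r r' : List ETok),
    flat Γ ++ cl () :: r = flat Δ ++ cl () :: r' → Γ = Δ ∧ r = r' := by
  induction Γ using Hedge.rec' with
  | nil =>
    rintro (_ | ⟨_ | _, Δ⟩) r r' e
    · simpa [flat_nil] using e
    · simp [flat_nil, flat_leaf] at e
    · simp [flat_nil, flat_node] at e
  | leaf A ts ih =>
    rintro (_ | ⟨_ | _, Δ⟩) r r' e
    · simp [flat_nil, flat_leaf] at e
    · simp only [flat_leaf, List.cons_append, List.cons.injEq, Tok.ty.injEq] at e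
      obtain ⟨rfl, e⟩ := e
      obtain ⟨rfl, rfl⟩ := ih _ _ _ e
      exact ⟨rfl, rfl⟩
    · simp [flat_leaf, flat_node] at e
  | node ts ts' ih ih' =>
    rintro (_ | ⟨_ | _, Δ⟩) r r' e
    · simp [flat_nil, flat_node] at e
    · simp [flat_leaf, flat_node] at e
    · simp only [flat_node, List.cons_append, List.append_assoc, List.cons.injEq, true_and] at e
      obtain ⟨rfl, e'⟩ := ih _ _ _ e
      obtain ⟨rfl, rfl⟩ := ih' _ _ _ e'
      exact ⟨rfl, rfl⟩

theorem flat_injective {Γ Δ : Hedge} (h : flat Γ = flat Δ) : Γ = Δ :=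
  (flat_cancel Γ Δ [] [] (by rw [h])).1

theorem exists_of_flat_prefix (Δ : Hedge) : ∀ (Γ : Hedge) (R : List ETok),
    flat Γ = flat Δ ++ R → ∃ Γ', Γ = Δ ++ Γ' ∧ R = flat Γ' := by
  induction Δ using Hedge.rec' with
  | nil => exact fun Γ R e => ⟨Γ, rfl, by simpa [flat_nil] using e.symm⟩
  | leaf A ts ih =>
    rintro (_ | ⟨_ | _, Γ⟩) R e
    · simp [flat_nil, flat_leaf] at e
    · simp only [flat_leaf, List.cons_append, List.cons.injEq, Tok.ty.injEq] at e
      obtain ⟨rfl, e⟩ := e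
      obtain ⟨Γ', rfl, h⟩ := ih _ _ e
      exact ⟨Γ', rfl, h⟩
    · simp [flat_leaf, flat_node] at e
  | node ts ts' ih ih' =>
    rintro (_ | ⟨_ | _, Γ⟩) R e
    · simp [flat_nil, flat_node] at e
    · simp [flat_leaf, flat_node] at e
    · simp only [flat_node, List.cons_append, List.append_assoc, List.cons.injEq, true_and] at e
      obtain ⟨rfl, e'⟩ := flat_cancel _ _ _ _ e
      obtain ⟨Γ', rfl, h⟩ := ih' _ _ e'
      exact ⟨Γ', rfl, h⟩

/-- The context `t Γ[■]`. -/
def Ctx.cons (t : Tree) : Ctx → Ctx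
  | .hole L R => .hole (t :: L) R
  | .node L c R => .node (t :: L) c R

theorem Ctx.fill_cons (t : Tree) (c : Ctx) (Δ : Hedge) : (c.cons t).fill Δ = t :: c.fill Δ := by
  cases c <;> rfl

/-- The part of the linear notation of a context to the left of the hole. -/
def Ctx.left : Ctx → List ETok
  | .hole L _ => flat L
  | .node L c _ => flat L ++ op () :: c.left

/-- The part of the linear notation of a context to the right of the hole. -/
def Ctx.right : Ctx → List ETok
  | .hole _ R => flat R
  | .node _ c R => c.right ++ cl () :: flat R

theorem Ctx.flat_fill (c : Ctx) (Δ : Hedge) : flat (c.fill Δ) = c.left ++ (flat Δ ++ c.right) := by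
  induction c with
  | hole L R => simp [fill, left, right, flat_append]
  | node L c R ih => simp [fill, left, right, flat_append, flat_node, ih]

/-- A factor of the string that is itself the notation of a hedge sits at a genuine hole; this turns
rules on strings back into rules in contexts. -/
theorem exists_ctx (Γ : Hedge) : ∀ (L R : List ETok) (Δ : Hedge),
    flat Γ = L ++ (flat Δ ++ R) → ∃ c : Ctx, Γ = c.fill Δ ∧ c.left = L ∧ c.right = R := by
  have nilcase : ∀ (Γ Δ : Hedge) (R : List ETok), flat Γ = flat Δ ++ R →
      ∃ c : Ctx, Γ = c.fill Δ ∧ c.left = [] ∧ c.right = R := by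
    intro Γ Δ R e
    obtain ⟨Γ', rfl, rfl⟩ := exists_of_flat_prefix Δ Γ R e
    exact ⟨.hole [] Γ', rfl, flat_nil, rfl⟩
  have hcons : ∀ (t : Tree) (c : Ctx), (c.cons t).left = t.flat ++ c.left ∧
      (c.cons t).right = c.right := by
    intro t c
    cases c <;> simp [Ctx.cons, Ctx.left, Ctx.right, flat]
  induction Γ using Hedge.rec' with
  | nil =>
    intro L R Δ e
    cases L with
    | nil => exact nilcase _ _ _ e
    | cons => simp [flat_nil] at e
  | leaf A ts ih =>
    intro L R Δ e
    cases L with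
    | nil => exact nilcase _ _ _ e
    | cons t L =>
      simp only [flat_leaf, List.cons_append, List.cons.injEq] at e
      obtain ⟨rfl, e⟩ := e
      obtain ⟨c, rfl, rfl, rfl⟩ := ih _ _ _ e
      exact ⟨c.cons (.leaf A), by rw [Ctx.fill_cons], by rw [(hcons _ _).1, Tree.flat]; rfl,
        (hcons _ _).2⟩
  | node ts ts' ih ih' =>
    intro L R Δ e
    cases L with
    | nil => exact nilcase _ _ _ e
    | cons t L =>
      simp only [flat_node, List.cons_append, List.cons.injEq] at e
      obtain ⟨rfl, e⟩ := e
      rcases three_split e.symm with ⟨X', rfl, e2⟩ | ⟨M₁, M₂, e1, e2, e3⟩ | ⟨Y₁, rfl, e2⟩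
      · obtain ⟨c, rfl, rfl, rfl⟩ := ih' _ _ _ e2
        exact ⟨c.cons (.node ts), by rw [Ctx.fill_cons], by rw [(hcons _ _).1, Tree.flat]; simp,
          (hcons _ _).2⟩
      · exfalso
        have hb := bal_flat ts
        rw [e2] at hb
        have q1 := hb.height_suffix
        have q2 := bal_flat Δ
        rw [e1] at q2
        have q3 := Bal.height_prefix (P := M₁ ++ [cl ()]) (Q := M₂) (by simpa using q2)
        simp at q3
        linarith
      · obtain ⟨c, rfl, rfl, rfl⟩ := ih _ _ _ e2
        exact ⟨.node [] c ts', by simp [Ctx.fill], by simp [Ctx.left, flat_nil],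
          by simp [Ctx.right]⟩

theorem exists_flat_eq {l : List ETok} (h : Bal l) : ∃ Γ, flat Γ = l := by
  induction h with
  | nil => exact ⟨[], flat_nil⟩
  | ty A _ ih =>
    obtain ⟨Γ, rfl⟩ := ih
    exact ⟨.leaf A :: Γ, flat_leaf A Γ⟩
  | br j _ _ ih₁ ih₂ =>
    obtain ⟨Γ, rfl⟩ := ih₁
    obtain ⟨Δ, rfl⟩ := ih₂
    exact ⟨.node Γ :: Δ, flat_node Γ Δ⟩

/-- Forgetting the labels of a token. -/
def eraseTok : LTok → ETok
  | .ty A => .ty A.erase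
  | .op _ => .op ()
  | .cl _ => .cl ()

theorem Bal.map_erase {l : List LTok} (h : Bal l) : Bal (l.map eraseTok) := by
  induction h with
  | nil => exact .nil
  | ty A _ ih => exact ih.ty _
  | br j _ _ ih₁ ih₂ => simpa [eraseTok] using ih₁.br () ih₂

theorem LDer.provable {l : List LTok} {C : LTy} (h : LDer l C) :
    ∀ Γ, flat Γ = l.map eraseTok → Provable Γ C.erase := by
  induction h with
  | init i x =>
    intro Γ e
    obtain rfl : Γ = [.leaf (.prim i)] :=
      flat_injective (by rw [e, flat_leaf, flat_nil]; rfl)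
    exact .init i
  | @ldivL L Γ' R A B C h₁ h₂ ih₁ ih₂ =>
    intro Γ e
    obtain ⟨Δ, hΔ⟩ := exists_flat_eq h₁.bal.map_erase
    obtain ⟨c, rfl, hl, hr⟩ := exists_ctx Γ (L.map eraseTok) (R.map eraseTok)
      (Δ ++ [.leaf (.ldiv A.erase B.erase)])
      (by simp [e, flat_append, flat_leaf, flat_nil, hΔ, eraseTok, LTy.erase])
    exact .ldivL c Δ _ _ _ (ih₁ Δ hΔ) (ih₂ _ (by
      simp [Ctx.flat_fill, hl, hr, flat_leaf, flat_nil, eraseTok]))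
  | ldivR h ih =>
    intro Γ e
    exact .ldivR _ _ _ (ih _ (by simp [flat_leaf, e, eraseTok]))
  | @rdivL L Γ' R A B C h₁ h₂ ih₁ ih₂ =>
    intro Γ e
    obtain ⟨Δ, hΔ⟩ := exists_flat_eq h₁.bal.map_erase
    obtain ⟨c, rfl, hl, hr⟩ := exists_ctx Γ (L.map eraseTok) (R.map eraseTok)
      (.leaf (.rdiv B.erase A.erase) :: Δ)
      (by simp [e, flat_leaf, hΔ, eraseTok, LTy.erase])
    exact .rdivL c Δ _ _ _ (ih₁ Δ hΔ) (ih₂ _ (by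
      simp [Ctx.flat_fill, hl, hr, flat_leaf, flat_nil, eraseTok]))
  | rdivR h ih =>
    intro Γ e
    exact .rdivR _ _ _ (ih _ (by simp [flat_append, flat_leaf, flat_nil, e, eraseTok]))
  | @prodL L R A B C h ih =>
    intro Γ e
    obtain ⟨c, rfl, hl, hr⟩ := exists_ctx Γ (L.map eraseTok) (R.map eraseTok)
      [.leaf (.prod A.erase B.erase)] (by simp [e, flat_leaf, flat_nil, eraseTok, LTy.erase])
    exact .prodL c _ _ _ (ih _ (by simp [Ctx.flat_fill, hl, hr, flat_leaf, flat_nil, eraseTok]))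
  | prodR h₁ h₂ ih₁ ih₂ =>
    intro Γ e
    obtain ⟨Γ₁, hΓ₁⟩ := exists_flat_eq h₁.bal.map_erase
    obtain ⟨Γ₂, hΓ₂⟩ := exists_flat_eq h₂.bal.map_erase
    obtain rfl : Γ = Γ₁ ++ Γ₂ := flat_injective (by simp [flat_append, e, hΓ₁, hΓ₂])
    exact .prodR _ _ _ _ (ih₁ _ hΓ₁) (ih₂ _ hΓ₂)
  | @diaL L R A C j h ih =>
    intro Γ e
    obtain ⟨c, rfl, hl, hr⟩ := exists_ctx Γ (L.map eraseTok) (R.map eraseTok)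
      [.leaf (.dia A.erase)] (by simp [e, flat_leaf, flat_nil, eraseTok, LTy.erase])
    exact .diaL c _ _ (ih _ (by
      simp [Ctx.flat_fill, hl, hr, flat_leaf, flat_node, flat_nil, eraseTok]))
  | @diaR Γ' A j h ih =>
    intro Γ e
    obtain ⟨Δ, hΔ⟩ := exists_flat_eq h.bal.map_erase
    obtain rfl : Γ = [.node Δ] :=
      flat_injective (by simp [e, flat_node, flat_nil, hΔ, eraseTok])
    exact .diaR _ _ (ih _ hΔ)
  | @boxL L R A C j h ih =>
    intro Γ e
    obtain ⟨c, rfl, hl, hr⟩ := exists_ctx Γ (L.map eraseTok) (R.map eraseTok)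
      [.node [.leaf (.box A.erase)]]
      (by simp [e, flat_leaf, flat_node, flat_nil, eraseTok, LTy.erase])
    exact .boxL c _ _ (ih _ (by simp [Ctx.flat_fill, hl, hr, flat_leaf, flat_nil, eraseTok]))
  | boxR hb h ih =>
    intro Γ e
    exact .boxR _ _ (ih _ (by simp [flat_node, flat_nil, e, eraseTok]))
  | @unitDiaL L R C j h ih =>
    intro Γ e
    obtain ⟨c, rfl, hl, hr⟩ := exists_ctx Γ (L.map eraseTok) (R.map eraseTok)
      [.leaf (.dia .one)] (by simp [e, flat_leaf, flat_nil, eraseTok, LTy.erase])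
    have key : Provable (c.fill [.node []]) C.erase := ih _ (by
      simp [Ctx.flat_fill, hl, hr, flat_node, flat_nil, eraseTok])
    -- The hole is moved inside the empty bracket, where the unit can be introduced before ◇ absorbs
    -- the bracket.
    obtain ⟨c', hc', hl', hr'⟩ := exists_ctx (c.fill [.node []]) (c.left ++ [op ()])
      (cl () :: c.right) [] (by simp [Ctx.flat_fill, flat_node, flat_nil])
    have h1 : c'.fill [.leaf .one] = c.fill [.node [.leaf .one]] :=
      flat_injective (by simp [Ctx.flat_fill, hl', hr', flat_node, flat_leaf, flat_nil])
    exact .diaL c _ _ (h1 ▸ Provable.oneL c' _ (hc' ▸ key))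
  | unitDiaR j =>
    intro Γ e
    obtain rfl : Γ = [.node []] :=
      flat_injective (by simp [e, flat_node, flat_nil, eraseTok])
    exact .diaR _ _ .oneR

-- Cut derivations of thin sequents

theorem LTy.guarded_erase {B : Finset ℕ} {A : LTy} (h : ∀ i x, .prim i x ∈ A.word → i ∈ B) :
    Guarded B A.erase := by
  induction A with
  | prim i x => exact .base (.inl ⟨i, h i x (by simp [word]), rfl⟩)
  | unitDia j => exact .base (.inr rfl)
  | ldiv A B ihA ihB =>
    exact .ldiv (ihA fun i x hx => h i x (by simp [word, hx]))
      (ihB fun i x hx => h i x (by simp [word, hx]))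
  | rdiv B A ihB ihA =>
    exact .rdiv (ihA fun i x hx => h i x (by simp [word, hx]))
      (ihB fun i x hx => h i x (by simp [word, hx]))
  | prod A B ihA ihB =>
    exact .prod (ihA fun i x hx => h i x (by simp [word, hx]))
      (ihB fun i x hx => h i x (by simp [word, hx]))
  | dia j A ih => exact .dia (ih fun i x hx => h i x (by simp [word, hx]))
  | box j A ih => exact .box (ih fun i x hx => h i x (by simp [word, hx]))

theorem mem_words_of_cnt_le {E : LTy} {l : List LTok} (h : ∀ q, E.cnt q ≤ wcnt q l) {q : Letter}
    (hq : q ∈ E.word) : q ∈ words l :=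
  List.count_pos_iff.1 (lt_of_lt_of_le (List.count_pos_iff.2 hq) (h q))

theorem word_subset_words {A : LTy} {l : List LTok} (h : ty A ∈ l) {q : Letter}
    (hq : q ∈ A.word) : q ∈ words l :=
  List.mem_flatMap.2 ⟨_, h, hq⟩

theorem CutDerivable.cut_flat {S : Set Sequent} {Γ Γ' : Hedge} {A C : Ty} {L R : List ETok}
    (h : CutDerivable S Γ A) (h' : CutDerivable S Γ' C) (e : flat Γ' = L ++ ty A :: R) :
    ∃ Γ'', flat Γ'' = L ++ (flat Γ ++ R) ∧ CutDerivable S Γ'' C := by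
  obtain ⟨c, rfl, rfl, rfl⟩ := exists_ctx Γ' L R [.leaf A] (by simp [e, flat_leaf, flat_nil])
  exact ⟨c.fill Γ, c.flat_fill Γ, .cut c Γ A C h h'⟩

theorem CutDerivable.cut_node {S : Set Sequent} {Γ : Hedge} {A C : Ty} (h : CutDerivable S Γ A)
    (h' : (⟨[.node [.leaf A]], C⟩ : Sequent) ∈ S) : CutDerivable S [.node Γ] C := by
  have := CutDerivable.cut (.node [] (.hole [] []) []) Γ A C h (by simpa [Ctx.fill] using .mem _ _ h')
  simpa [Ctx.fill] using this

/-- The side conditions on the types of a sequent. -/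
structure Small (B : Finset ℕ) (m : ℕ) (l : List LTok) : Prop where
  prim_mem : ∀ i x, .prim i x ∈ words l → i ∈ B
  length_le : ∀ A, ty A ∈ l → A.word.length ≤ m

theorem Small.guarded {B : Finset ℕ} {m : ℕ} {l : List LTok} (h : Small B m l) {A : LTy}
    (hA : ty A ∈ l) : Guarded B A.erase ∧ A.erase.length ≤ m :=
  ⟨LTy.guarded_erase fun i x hx => h.prim_mem i x (word_subset_words hA hx),
    A.length_word ▸ h.length_le A hA⟩

theorem small_cons_iff {B : Finset ℕ} {m : ℕ} {t : LTok} {l : List LTok} :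
    Small B m (t :: l) ↔ Small B m [t] ∧ Small B m l := by
  constructor
  · refine fun h => ⟨⟨fun i x hx => h.1 i x ?_, fun A hA => h.2 A ?_⟩,
      ⟨fun i x hx => h.1 i x ?_, fun A hA => h.2 A ?_⟩⟩
    · rw [words_cons, words_nil] at hx; rw [words_cons]; simp at hx; simp [hx]
    · simp at hA; simp [hA]
    · rw [words_cons]; simp [hx]
    · simp [hA]
  · rintro ⟨h, h'⟩
    refine ⟨fun i x hx => ?_, fun A hA => ?_⟩
    · rw [words_cons, List.mem_append] at hx
      exact hx.elim (fun hx => h.1 i x (by simpa [words_cons, words_nil] using hx)) (h'.1 i x)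
    · exact (List.mem_cons.1 hA).elim (fun hA => h.2 A (by simp [hA])) (h'.2 A)

theorem small_append_iff {B : Finset ℕ} {m : ℕ} {l l' : List LTok} :
    Small B m (l ++ l') ↔ Small B m l ∧ Small B m l' := by
  induction l with
  | nil => exact ⟨fun h => ⟨⟨by simp [words_nil], by simp⟩, h⟩, fun h => h.2⟩
  | cons t l ih => rw [List.cons_append, small_cons_iff, ih, small_cons_iff (l := l), and_assoc]

theorem small_of_cnt_le {B : Finset ℕ} {m : ℕ} {l : List LTok} (h : Small B m l) {E : LTy}
    (hE : ∀ q, E.cnt q ≤ wcnt q l) (hm : E.word.length ≤ m) : Small B m [ty E] :=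
  ⟨fun i x hx => h.1 i x (mem_words_of_cnt_le hE (by simpa [words_cons, words_nil, tokWord] using hx)),
    by simpa using hm⟩

theorem small_op {B : Finset ℕ} {m j : ℕ} : Small B m [op j] :=
  ⟨by simp [words_cons, words_nil, tokWord], by simp⟩

theorem small_cl {B : Finset ℕ} {m j : ℕ} : Small B m [cl j] :=
  ⟨by simp [words_cons, words_nil, tokWord], by simp⟩

theorem mem_setS {B : Finset ℕ} {m : ℕ} {As : List LTy} {C : LTy} (h : LDer (As.map ty) C)
    (hs : Small B m (As.map ty)) (hC : Small B m [ty C]) (h2 : As.length ≤ 2) :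
    (⟨(As.map LTy.erase).map Tree.leaf, C.erase⟩ : Sequent) ∈ setT B m := by
  refine .inl (.inl (.inl ⟨As.map LTy.erase, C.erase, by simpa using h2, ?_,
    hC.guarded (by simp), h.provable _ ?_, rfl⟩))
  · intro A hA
    obtain ⟨A', hA', rfl⟩ := List.mem_map.1 hA
    exact hs.guarded (List.mem_map_of_mem hA')
  · rw [flat_map_leaf]
    simp [eraseTok]

/-- Thin sequents with small types are derivable by Cut only. -/
theorem Thin.cutDerivable {B : Finset ℕ} {m : ℕ} (n : ℕ) : ∀ {l : List LTok} {C : LTy},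
    l.length ≤ n → Thin l C → Small B m l → Small B m [ty C] →
    ∃ Γ, flat Γ = l.map eraseTok ∧ CutDerivable (setT B m) Γ C.erase := by
  induction n with
  | zero =>
    intro l C hn h hl hC
    obtain rfl : l = [] := List.eq_nil_of_length_eq_zero (by omega)
    exact ⟨[], flat_nil, .mem _ _ (mem_setS (As := []) h.der hl hC (by simp))⟩
  | succ n ih =>
    intro l C hn h hl hC
    have h2 := h.le_two
    rcases h.der.bal.exists_bracket with ⟨As, rfl⟩ | ⟨X, j, M, Y, rfl, hM⟩
    · by_cases hAs : As.length ≤ 2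
      · exact ⟨_, by rw [flat_map_leaf]; simp [eraseTok], .mem _ _ (mem_setS h.der hl hC hAs)⟩
      · obtain ⟨X, A, D, Y, rfl, hE⟩ := h.exists_pair (fun A hA => hl.2 A (List.mem_map_of_mem hA))
          (hC.2 C (by simp)) (by omega)
        obtain ⟨E, d₁, d₂, c⟩ := h.der.interpolation (X := X.map ty) (Φ := [ty A, ty D])
          (Y := Y.map ty) (by simp) ((Bal.single D).ty A) (by simp)
        simp only [List.map_append, List.map_cons, small_append_iff, small_cons_iff (l := _ :: _),
          small_cons_iff (l := Y.map ty)] at hl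
        obtain ⟨hX, hA, hD, hY⟩ := hl
        have hAD : Small B m [ty A, ty D] := small_cons_iff.2 ⟨hA, hD⟩
        have sE : Small B m [ty E] := small_of_cnt_le hAD (fun q => (c q).1) (hE E c)
        obtain ⟨Γ, hΓ, hd⟩ := ih (l := X.map ty ++ ty E :: Y.map ty) (C := C)
          (by simp at hn ⊢; omega) ⟨d₂, fun q => by
            have := c q
            have := h2 q
            simp only [List.map_append, List.map_cons, wcnt_append, wcnt_ty, wcnt_nil] at *
            omega⟩ (small_append_iff.2 ⟨hX, small_cons_iff.2 ⟨sE, hY⟩⟩) hC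
        obtain ⟨Γ', hΓ', hd'⟩ := CutDerivable.cut_flat
          (.mem _ _ (mem_setS (As := [A, D]) d₁ hAD sE (by simp))) hd
          (L := (X.map ty).map eraseTok) (R := (Y.map ty).map eraseTok)
          (by simp [hΓ, eraseTok])
        exact ⟨Γ', by rw [hΓ', flat_map_leaf]; simp [eraseTok], hd'⟩
    · have hbr := h.bracket hl.2 (hC.2 C (by simp))
      rw [small_append_iff, small_cons_iff, small_append_iff, small_cons_iff] at hl
      obtain ⟨hX, -, hsM, hY⟩ := hl
      replace hY := (small_cons_iff.1 hY).2
      -- Removing both bracket tokens leaves room for the one interpolant that replaces the bracket.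
      have hlen : X.length + M.length + Y.length ≤ n - 1 ∧ 1 ≤ n := by simp at hn; omega
      rcases hbr with ⟨hne, hF⟩ | ⟨hm, hE⟩
      · obtain ⟨F, d₁, d₂, c⟩ := h.der.interpolation (X := X) (Φ := op j :: (M ++ [cl j]))
          (Y := Y) (by simp) (hM.bracket j) (by simp)
        have hF' := hF F c
        have hMlen : 0 < M.length := List.length_pos_of_ne_nil hne
        have sF : Small B m [ty F] := small_of_cnt_le
          (small_cons_iff.2 ⟨small_op, small_append_iff.2 ⟨hsM, small_cl⟩⟩)
          (fun q => (c q).1) (by omega)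
        have sF' : Small B m [ty (.box j F)] := ⟨fun i x hx => sF.1 i x (by
          simpa [words_cons, words_nil, tokWord, LTy.word] using hx), by
          simp [LTy.word]; omega⟩
        -- The interpolant `F` of the whole bracket gives M ⇒ □F; the axiom for ⟨□F⟩ then restores
        -- the bracket.
        obtain ⟨Γ₁, hΓ₁, e₁⟩ := ih (l := M) (C := .box j F) (by omega) ⟨.boxR hM d₁, fun q => by
            have := c q
            have := h2 q
            simp only [wcnt_append, wcnt_op, wcnt_cl, wcnt_nil, cnt_box] at *
            omega⟩ hsM sF'
        obtain ⟨Γ₂, hΓ₂, e₂⟩ := ih (l := X ++ ty F :: Y) (C := C) (by simp; omega)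
          ⟨d₂, fun q => by
            have := c q
            have := h2 q
            simp only [wcnt_append, wcnt_op, wcnt_cl, wcnt_nil, wcnt_ty] at *
            omega⟩ (small_append_iff.2 ⟨hX, small_cons_iff.2 ⟨sF, hY⟩⟩) hC
        have e₃ : CutDerivable (setT B m) [.node Γ₁] F.erase := CutDerivable.cut_node e₁
          (.inr ⟨F.erase, (sF.guarded (by simp)).1, by rw [← F.length_word]; exact hF', rfl⟩)
        obtain ⟨Γ', hΓ', hd'⟩ := e₃.cut_flat e₂
          (L := X.map eraseTok) (R := Y.map eraseTok) (by simp [hΓ₂, eraseTok])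
        exact ⟨Γ', by rw [hΓ']; simp [flat_node, flat_nil, hΓ₁, eraseTok], hd'⟩
      · by_cases hne : M = []
        · subst hne
          have sF : Small B m [ty (.unitDia j)] := ⟨by
            simp [words_cons, words_nil, tokWord, LTy.word], by simpa [LTy.word] using hm⟩
          obtain ⟨Γ₂, hΓ₂, e₂⟩ := ih (l := X ++ ty (.unitDia j) :: Y) (C := C)
            (by simp at hlen ⊢; omega)
            ⟨.unitDiaL (by simpa using h.der), fun q => by
              have := h2 q
              simp only [wcnt_append, wcnt_op, wcnt_cl, wcnt_nil, wcnt_ty, cnt_unitDia] at *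
              omega⟩ (small_append_iff.2 ⟨hX, small_cons_iff.2 ⟨sF, hY⟩⟩) hC
          obtain ⟨Γ', hΓ', hd'⟩ := CutDerivable.cut_flat
            (S := setT B m) (.mem [.node []] (.dia .one) (.inl (.inl (.inr rfl)))) e₂
            (L := X.map eraseTok) (R := Y.map eraseTok) (by simp [hΓ₂, eraseTok, LTy.erase])
          exact ⟨Γ', by rw [hΓ']; simp [flat_node, flat_nil, eraseTok], hd'⟩
        · obtain ⟨E, d₁, d₂, c⟩ := h.der.interpolation (X := X ++ [op j]) (Φ := M)
            (Y := cl j :: Y) (by simp) hM hne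
          have hE' := hE E c
          have hMlen : 0 < M.length := List.length_pos_of_ne_nil hne
          have sE : Small B m [ty E] := small_of_cnt_le hsM (fun q => (c q).1) (by omega)
          have sE' : Small B m [ty (.dia j E)] := ⟨fun i x hx => sE.1 i x (by
            simpa [words_cons, words_nil, tokWord, LTy.word] using hx), by
            simp [LTy.word]; omega⟩
          obtain ⟨Γ₁, hΓ₁, e₁⟩ := ih (l := M) (C := E) (by omega) ⟨d₁, fun q => by
              have := c q
              have := h2 q
              simp only [wcnt_append, wcnt_op, wcnt_cl, wcnt_nil] at *
              omega⟩ hsM sE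
          -- The interpolant `E` of the content leaves its bracket behind in the other sequent,
          -- where ◇ absorbs it; the axiom for ⟨E⟩ joins the two.
          obtain ⟨Γ₂, hΓ₂, e₂⟩ := ih (l := X ++ ty (.dia j E) :: Y) (C := C) (by simp; omega)
            ⟨.diaL (by simpa using d₂), fun q => by
              have := c q
              have := h2 q
              simp only [wcnt_append, wcnt_op, wcnt_cl, wcnt_nil, wcnt_ty, cnt_dia] at *
              omega⟩ (small_append_iff.2 ⟨hX, small_cons_iff.2 ⟨sE', hY⟩⟩) hC
          have e₃ : CutDerivable (setT B m) [.node Γ₁] (.dia E.erase) := CutDerivable.cut_node e₁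
            (.inl (.inr ⟨E.erase, (sE.guarded (by simp)).1,
              by rw [← E.length_word]; exact hE', rfl⟩))
          obtain ⟨Γ', hΓ', hd'⟩ := e₃.cut_flat e₂
            (L := X.map eraseTok) (R := Y.map eraseTok) (by simp [hΓ₂, eraseTok, LTy.erase])
          exact ⟨Γ', by rw [hΓ']; simp [flat_node, flat_nil, hΓ₁, eraseTok], hd'⟩

-- Thin labellings and the rules

/-- The label of a letter. -/
def Letter.label : Letter → ℕ
  | prim _ x => x
  | opn j => j
  | cls j => j

/-- The sequent `l ⇒ C` carries a thin labelling by fresh labels. -/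
def Labellable (l : List ETok) (C : Ty) : Prop :=
  ∀ k, ∃ k' l' C', k ≤ k' ∧ l'.map eraseTok = l ∧ C'.erase = C ∧ LDer l' C' ∧
    ∀ q : Letter, wcnt q l' + C'.cnt q ≤ 2 ∧
      (0 < wcnt q l' + C'.cnt q → k ≤ q.label ∧ q.label < k')

theorem eraseTok_eq_ty {t : LTok} {A : Ty} (h : eraseTok t = .ty A) :
    ∃ A', t = ty A' ∧ A'.erase = A := by
  cases t <;> simp_all [eraseTok]

theorem eraseTok_eq_op {t : LTok} (h : eraseTok t = .op ()) : ∃ j, t = op j := by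
  cases t <;> simp_all [eraseTok]

theorem eraseTok_eq_cl {t : LTok} (h : eraseTok t = .cl ()) : ∃ j, t = cl j := by
  cases t <;> simp_all [eraseTok]

theorem map_erase_eq_ty {l : List LTok} {L R : List ETok} {A : Ty}
    (h : l.map eraseTok = L ++ ty A :: R) : ∃ L' A' R', l = L' ++ ty A' :: R' ∧
      L'.map eraseTok = L ∧ A'.erase = A ∧ R'.map eraseTok = R := by
  obtain ⟨L', r, rfl, hL, hr⟩ := List.map_eq_append_iff.1 h
  obtain ⟨t, R', rfl, ht, hR⟩ := List.map_eq_cons_iff.1 hr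
  obtain ⟨A', rfl, hA⟩ := eraseTok_eq_ty ht
  exact ⟨L', A', R', rfl, hL, hA, hR⟩

theorem map_erase_eq_op {l : List LTok} {L R : List ETok}
    (h : l.map eraseTok = L ++ op () :: R) : ∃ L' j R', l = L' ++ op j :: R' ∧
      L'.map eraseTok = L ∧ R'.map eraseTok = R := by
  obtain ⟨L', r, rfl, hL, hr⟩ := List.map_eq_append_iff.1 h
  obtain ⟨t, R', rfl, ht, hR⟩ := List.map_eq_cons_iff.1 hr
  obtain ⟨j, rfl⟩ := eraseTok_eq_op ht
  exact ⟨L', j, R', rfl, hL, hR⟩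

theorem map_erase_eq_cl {l : List LTok} {L R : List ETok}
    (h : l.map eraseTok = L ++ cl () :: R) : ∃ L' j R', l = L' ++ cl j :: R' ∧
      L'.map eraseTok = L ∧ R'.map eraseTok = R := by
  obtain ⟨L', r, rfl, hL, hr⟩ := List.map_eq_append_iff.1 h
  obtain ⟨t, R', rfl, ht, hR⟩ := List.map_eq_cons_iff.1 hr
  obtain ⟨j, rfl⟩ := eraseTok_eq_cl ht
  exact ⟨L', j, R', rfl, hL, hR⟩

theorem height_map_erase (l : List LTok) : height (l.map eraseTok) = height l := by
  induction l with
  | nil => rfl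
  | cons t l ih => cases t <;> simp [eraseTok, ih]

theorem count_opn_add_count_cls_le (q : Letter) (k : ℕ) :
    [Letter.opn k].count q + [Letter.cls k].count q ≤ 1 ∧
    (0 < [Letter.opn k].count q + [Letter.cls k].count q → q.label = k) := by
  cases q <;> simp [List.count_cons, Letter.label] <;> split_ifs <;> simp_all

namespace Labellable

theorem bal {l : List ETok} {C : Ty} (h : Labellable l C) : Bal l := by
  obtain ⟨_, l', _, _, rfl, _, d, _⟩ := h 0
  exact d.bal.map_erase

theorem init (i : ℕ) : Labellable [ty (.prim i)] (.prim i) := by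
  intro k
  refine ⟨k + 1, [ty (.prim i k)], .prim i k, by omega, rfl, rfl, .init i k, fun q => ?_⟩
  simp only [wcnt_ty, wcnt_nil, LTy.cnt, LTy.word, List.count_cons, List.count_nil]
  split_ifs with h
  · simp at h
    subst h
    simp [Letter.label]
  · simp

/-- The second premise takes its labels from where the first one stopped, so the premises share no
letter and the bound of two survives. The same device serves the other two-premise rules. -/
theorem ldivL {L Γ R : List ETok} {A B C : Ty} (h₁ : Labellable Γ A)
    (h₂ : Labellable (L ++ ty B :: R) C) : Labellable (L ++ (Γ ++ ty (.ldiv A B) :: R)) C := by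
  intro k
  obtain ⟨k₁, Γ', A', hk₁, rfl, rfl, d₁, c₁⟩ := h₁ k
  obtain ⟨k₂, l', C', hk₂, e, rfl, d₂, c₂⟩ := h₂ k₁
  obtain ⟨L', B', R', rfl, rfl, rfl, rfl⟩ := map_erase_eq_ty e
  refine ⟨k₂, _, C', hk₁.trans hk₂, ?_, rfl, .ldivL d₁ d₂, fun q => ?_⟩
  · simp [eraseTok, LTy.erase]
  · have := c₁ q
    have := c₂ q
    simp only [wcnt_append, wcnt_ty, cnt_ldiv] at *; omega

theorem ldivR {Γ : List ETok} {A B : Ty} (h : Labellable (ty A :: Γ) B) :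
    Labellable Γ (.ldiv A B) := by
  intro k
  obtain ⟨k₂, l', C', hk₂, e, rfl, d₂, c₂⟩ := h k
  obtain ⟨L', A', R', rfl, hL, rfl, rfl⟩ := map_erase_eq_ty (L := []) e
  obtain rfl := List.map_eq_nil_iff.1 hL
  refine ⟨k₂, _, _, hk₂, rfl, rfl, .ldivR d₂, fun q => ?_⟩
  have := c₂ q
  simp only [List.nil_append, wcnt_ty, cnt_ldiv] at *; omega

theorem rdivL {L Γ R : List ETok} {A B C : Ty} (h₁ : Labellable Γ A)
    (h₂ : Labellable (L ++ ty B :: R) C) : Labellable (L ++ ty (.rdiv B A) :: (Γ ++ R)) C := by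
  intro k
  obtain ⟨k₁, Γ', A', hk₁, rfl, rfl, d₁, c₁⟩ := h₁ k
  obtain ⟨k₂, l', C', hk₂, e, rfl, d₂, c₂⟩ := h₂ k₁
  obtain ⟨L', B', R', rfl, rfl, rfl, rfl⟩ := map_erase_eq_ty e
  refine ⟨k₂, _, C', hk₁.trans hk₂, ?_, rfl, .rdivL d₁ d₂, fun q => ?_⟩
  · simp [eraseTok, LTy.erase]
  · have := c₁ q
    have := c₂ q
    simp only [wcnt_append, wcnt_ty, cnt_rdiv] at *; omega

theorem rdivR {Γ : List ETok} {A B : Ty} (h : Labellable (Γ ++ [ty A]) B) :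
    Labellable Γ (.rdiv B A) := by
  intro k
  obtain ⟨k₂, l', C', hk₂, e, rfl, d₂, c₂⟩ := h k
  obtain ⟨L', A', R', rfl, rfl, rfl, hR⟩ := map_erase_eq_ty e
  obtain rfl := List.map_eq_nil_iff.1 hR
  refine ⟨k₂, _, _, hk₂, rfl, rfl, .rdivR d₂, fun q => ?_⟩
  have := c₂ q
  simp only [wcnt_append, wcnt_ty, wcnt_nil, cnt_rdiv] at *; omega

theorem prodL {L R : List ETok} {A B C : Ty} (h : Labellable (L ++ ty A :: ty B :: R) C) :
    Labellable (L ++ ty (.prod A B) :: R) C := by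
  intro k
  obtain ⟨k₂, l', C', hk₂, e, rfl, d₂, c₂⟩ := h k
  obtain ⟨L', A', R', rfl, rfl, rfl, e'⟩ := map_erase_eq_ty e
  obtain ⟨L'', B', R', rfl, hL, rfl, rfl⟩ := map_erase_eq_ty (L := []) e'
  obtain rfl := List.map_eq_nil_iff.1 hL
  refine ⟨k₂, _, C', hk₂, ?_, rfl, .prodL d₂, fun q => ?_⟩
  · simp [eraseTok, LTy.erase]
  · have := c₂ q
    simp only [List.nil_append, wcnt_append, wcnt_ty, cnt_prod] at *; omega

theorem prodR {Γ Δ : List ETok} {A B : Ty} (h₁ : Labellable Γ A) (h₂ : Labellable Δ B) :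
    Labellable (Γ ++ Δ) (.prod A B) := by
  intro k
  obtain ⟨k₁, Γ', A', hk₁, rfl, rfl, d₁, c₁⟩ := h₁ k
  obtain ⟨k₂, Δ', B', hk₂, rfl, rfl, d₂, c₂⟩ := h₂ k₁
  refine ⟨k₂, _, _, hk₁.trans hk₂, ?_, rfl, .prodR d₁ d₂, fun q => ?_⟩
  · simp
  · have := c₁ q
    have := c₂ q
    simp only [wcnt_append, cnt_prod] at *; omega

theorem diaL {L R : List ETok} {A C : Ty} (h : Labellable (L ++ op () :: ty A :: cl () :: R) C) :
    Labellable (L ++ ty (.dia A) :: R) C := by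
  intro k
  obtain ⟨k₂, l', C', hk₂, e, rfl, d₂, c₂⟩ := h k
  obtain ⟨L', i, R', rfl, rfl, e₁⟩ := map_erase_eq_op e
  obtain ⟨L'', A', R', rfl, hL, rfl, e₂⟩ := map_erase_eq_ty (L := []) e₁
  obtain rfl := List.map_eq_nil_iff.1 hL
  obtain ⟨L'', j, R', rfl, hL, rfl⟩ := map_erase_eq_cl (L := []) e₂
  obtain rfl := List.map_eq_nil_iff.1 hL
  -- The labelled rule demands equal labels on the pair; balance of derivable strings supplies this.
  obtain rfl : i = j := d₂.bal.label_eq (M := [ty A']) rfl (Bal.single A')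
  refine ⟨k₂, _, C', hk₂, ?_, rfl, .diaL d₂, fun q => ?_⟩
  · simp [eraseTok, LTy.erase]
  · have := c₂ q
    simp only [List.nil_append, wcnt_append, wcnt_ty, wcnt_op, wcnt_cl, cnt_dia] at *; omega

theorem diaR {Γ : List ETok} {A : Ty} (h : Labellable Γ A) :
    Labellable (op () :: (Γ ++ [cl ()])) (.dia A) := by
  intro k
  -- Label `k` is kept free for the new bracket.
  obtain ⟨k₂, l', C', hk₂, rfl, rfl, d₂, c₂⟩ := h (k + 1)
  refine ⟨k₂, _, _, by omega, ?_, rfl, .diaR k d₂, fun q => ?_⟩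
  · simp [eraseTok]
  · have := c₂ q
    have := count_opn_add_count_cls_le q k
    simp only [wcnt_append, wcnt_nil, wcnt_op, wcnt_cl, cnt_dia] at *; omega

theorem boxL {L R : List ETok} {A C : Ty} (h : Labellable (L ++ ty A :: R) C) :
    Labellable (L ++ op () :: ty (.box A) :: cl () :: R) C := by
  intro k
  obtain ⟨k₂, l', C', hk₂, e, rfl, d₂, c₂⟩ := h (k + 1)
  obtain ⟨L', A', R', rfl, rfl, rfl, rfl⟩ := map_erase_eq_ty e
  refine ⟨k₂, _, _, by omega, ?_, rfl, .boxL k d₂, fun q => ?_⟩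
  · simp [eraseTok, LTy.erase]
  · have := c₂ q
    have := count_opn_add_count_cls_le q k
    simp only [wcnt_append, wcnt_ty, wcnt_op, wcnt_cl, cnt_box] at *; omega

theorem boxR {Γ : List ETok} {A : Ty} (hb : Bal Γ) (h : Labellable (op () :: (Γ ++ [cl ()])) A) :
    Labellable Γ (.box A) := by
  intro k
  obtain ⟨k₂, l', C', hk₂, e, rfl, d₂, c₂⟩ := h k
  obtain ⟨L', i, R', rfl, hL, e₁⟩ := map_erase_eq_op (L := []) e
  obtain rfl := List.map_eq_nil_iff.1 hL
  obtain ⟨Γ', j, R', rfl, rfl, hR⟩ := map_erase_eq_cl e₁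
  obtain rfl := List.map_eq_nil_iff.1 hR
  have hb' : Bal Γ' := d₂.bal.of_bracket fun P Q e => by
    subst e
    rw [List.map_append] at hb
    rw [← height_map_erase]
    exact hb.height_prefix
  obtain rfl : i = j := d₂.bal.label_eq (L := []) rfl hb'
  refine ⟨k₂, _, _, hk₂, rfl, rfl, .boxR hb' d₂, fun q => ?_⟩
  have := c₂ q
  simp only [List.nil_append, wcnt_append, wcnt_nil, wcnt_op, wcnt_cl, cnt_box] at *; omega

theorem unitDiaL {L R : List ETok} {C : Ty} (h : Labellable (L ++ op () :: cl () :: R) C) :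
    Labellable (L ++ ty (.dia .one) :: R) C := by
  intro k
  obtain ⟨k₂, l', C', hk₂, e, rfl, d₂, c₂⟩ := h k
  obtain ⟨L', i, R', rfl, rfl, e₁⟩ := map_erase_eq_op e
  obtain ⟨L'', j, R', rfl, hL, rfl⟩ := map_erase_eq_cl (L := []) e₁
  obtain rfl := List.map_eq_nil_iff.1 hL
  obtain rfl : i = j := d₂.bal.label_eq (M := []) rfl .nil
  refine ⟨k₂, _, C', hk₂, ?_, rfl, .unitDiaL d₂, fun q => ?_⟩
  · simp [eraseTok, LTy.erase]
  · have := c₂ q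
    simp only [List.nil_append, wcnt_append, wcnt_ty, wcnt_op, wcnt_cl, cnt_unitDia] at *; omega

theorem unitDiaR : Labellable [op (), cl ()] (.dia .one) := by
  intro k
  refine ⟨k + 1, [op k, cl k], .unitDia k, by omega, rfl, rfl, .unitDiaR k, fun q => ?_⟩
  have := count_opn_add_count_cls_le q k
  simp only [wcnt_op, wcnt_cl, wcnt_nil, cnt_unitDia]; omega

end Labellable

-- The phase model

/-- The closure operator of the phase model of token strings. -/
def phaseClosure (S : Set (List ETok)) : Set (List ETok) :=
  {l | Bal l ∧ ∀ L R C, (∀ x ∈ S, Labellable (L ++ (x ++ R)) C) → Labellable (L ++ (l ++ R)) C}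

/-- The interpretation of types in the phase model. -/
def Ty.interp : Ty → Set (List ETok)
  | prim i => {l | Labellable l (.prim i)}
  | one => phaseClosure {[]}
  | ldiv A B => {l | Bal l ∧ ∀ x ∈ A.interp, x ++ l ∈ B.interp}
  | rdiv B A => {l | Bal l ∧ ∀ x ∈ A.interp, l ++ x ∈ B.interp}
  | prod A B => phaseClosure {l | ∃ x ∈ A.interp, ∃ y ∈ B.interp, l = x ++ y}
  | dia A => phaseClosure {l | ∃ x ∈ A.interp, l = op () :: (x ++ [cl ()])}
  | box A => {l | Bal l ∧ op () :: (l ++ [cl ()]) ∈ A.interp}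

theorem Ty.bal_of_mem_interp {A : Ty} {l : List ETok} (h : l ∈ A.interp) : Bal l := by
  cases A with
  | prim i => exact Labellable.bal h
  | one => exact h.1
  | ldiv A B => exact h.1
  | rdiv B A => exact h.1
  | prod A B => exact h.1
  | dia A => exact h.1
  | box A => exact h.1

theorem subset_phaseClosure {S : Set (List ETok)} {l : List ETok} (hb : Bal l) (h : l ∈ S) :
    l ∈ phaseClosure S :=
  ⟨hb, fun _ _ _ hS => hS l h⟩

theorem phaseClosure_closed {S : Set (List ETok)} {l : List ETok} (hb : Bal l)
    (h : ∀ L R C, (∀ x ∈ phaseClosure S, Labellable (L ++ (x ++ R)) C) →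
      Labellable (L ++ (l ++ R)) C) : l ∈ phaseClosure S :=
  ⟨hb, fun L R C hS => h L R C fun _ hx => hx.2 L R C hS⟩

/-- Interpretations are closed sets: membership may be tested by what is labellable in all
surroundings. For divisions and the box, closedness is inherited by enlarging the surroundings. -/
theorem Ty.interp_closed {A : Ty} : ∀ {l : List ETok}, Bal l →
    (∀ L R C, (∀ x ∈ A.interp, Labellable (L ++ (x ++ R)) C) → Labellable (L ++ (l ++ R)) C) →
    l ∈ A.interp := by
  induction A with
  | prim i =>
    intro l _ h
    have := h [] [] (.prim i) fun x hx => by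
      rw [List.nil_append, List.append_nil]
      exact hx
    rwa [List.nil_append, List.append_nil] at this
  | one => exact phaseClosure_closed
  | ldiv A B _ ihB =>
    refine fun {l} hb h => ⟨hb, fun x hx => ihB ((bal_of_mem_interp hx).append hb) ?_⟩
    intro L R C hB
    have := h (L ++ x) R C fun y hy => by simpa using hB _ (hy.2 x hx)
    simpa using this
  | rdiv B A ihB _ =>
    refine fun {l} hb h => ⟨hb, fun x hx => ihB (hb.append (bal_of_mem_interp hx)) ?_⟩
    intro L R C hB
    have := h L (x ++ R) C fun y hy => by simpa using hB _ (hy.2 x hx)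
    simpa using this
  | prod A B => exact phaseClosure_closed
  | dia A => exact phaseClosure_closed
  | box A ih =>
    refine fun {l} hb h => ⟨hb, ih (hb.bracket ()) ?_⟩
    intro L R C hA
    have := h (L ++ [op ()]) (cl () :: R) C fun y hy => by simpa using hA _ hy.2
    simpa using this

/-- For the left rules of product, ◇ and the unit it suffices to treat the generators of the
closure. -/
theorem Ty.mem_interp_of_phaseClosure {A : Ty} {S : Set (List ETok)} {L x R : List ETok}
    (hx : x ∈ phaseClosure S) (hb : Bal (L ++ (x ++ R))) (h : ∀ s ∈ S, L ++ (s ++ R) ∈ A.interp) :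
    L ++ (x ++ R) ∈ A.interp := by
  refine interp_closed hb fun L' R' C hA => ?_
  have := hx.2 (L' ++ L) (R ++ R') C fun s hs => by simpa using hA _ (h s hs)
  simpa using this

/-- Token strings in the interpretation of a hedge. -/
inductive Realizes : Hedge → List ETok → Prop
  | nil : Realizes [] []
  | leaf {A : Ty} {ts : Hedge} {x y : List ETok} : x ∈ A.interp → Realizes ts y →
      Realizes (.leaf A :: ts) (x ++ y)
  | node {ts ts' : Hedge} {x y : List ETok} : Realizes ts x → Realizes ts' y →
      Realizes (.node ts :: ts') (op () :: (x ++ cl () :: y))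

namespace Realizes

theorem bal {Γ : Hedge} {l : List ETok} (h : Realizes Γ l) : Bal l := by
  induction h with
  | nil => exact .nil
  | leaf hx _ ih => exact (Ty.bal_of_mem_interp hx).append ih
  | node _ _ ih₁ ih₂ => exact ih₁.br () ih₂

theorem single {A : Ty} {x : List ETok} (h : x ∈ A.interp) : Realizes [.leaf A] x := by
  simpa using Realizes.leaf h .nil

theorem of_single {A : Ty} {x : List ETok} (h : Realizes [.leaf A] x) : x ∈ A.interp := by
  cases h with
  | leaf hx h => cases h; simpa using hx

theorem bracket {Γ : Hedge} {x : List ETok} (h : Realizes Γ x) :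
    Realizes [.node Γ] (op () :: (x ++ [cl ()])) :=
  .node h .nil

theorem of_bracket {Γ : Hedge} {x : List ETok} (h : Realizes [.node Γ] x) :
    ∃ y, Realizes Γ y ∧ x = op () :: (y ++ [cl ()]) := by
  cases h with
  | node hx h => cases h; exact ⟨_, hx, rfl⟩

theorem append {Γ Δ : Hedge} {x y : List ETok} (h : Realizes Γ x) (h' : Realizes Δ y) :
    Realizes (Γ ++ Δ) (x ++ y) := by
  induction h with
  | nil => exact h'
  | leaf hx _ ih => simpa using ih.leaf hx
  | node h₁ _ _ ih => simpa using h₁.node ih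

theorem of_append {Γ Δ : Hedge} : ∀ {l : List ETok}, Realizes (Γ ++ Δ) l →
    ∃ x y, Realizes Γ x ∧ Realizes Δ y ∧ l = x ++ y := by
  induction Γ with
  | nil => exact fun {l} h => ⟨[], l, .nil, h, rfl⟩
  | cons t Γ ih =>
    intro l h
    cases h with
    | leaf hx h =>
      obtain ⟨x, y, h₁, h₂, rfl⟩ := ih h
      exact ⟨_, y, h₁.leaf hx, h₂, by simp⟩
    | node hx h =>
      obtain ⟨x, y, h₁, h₂, rfl⟩ := ih h
      exact ⟨_, y, hx.node h₁, h₂, by simp⟩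

/-- The surroundings `L` and `R` are chosen once and work for every filling of the hole, so premise
and conclusion of a left rule can be compared. -/
theorem of_fill (c : Ctx) : ∀ {Δ : Hedge} {l : List ETok}, Realizes (c.fill Δ) l →
    ∃ L x R, l = L ++ (x ++ R) ∧ Realizes Δ x ∧
      ∀ Δ' x', Realizes Δ' x' → Realizes (c.fill Δ') (L ++ (x' ++ R)) := by
  induction c with
  | hole L R =>
    intro Δ l h
    obtain ⟨w, y, h₁, h₂, rfl⟩ := of_append h
    obtain ⟨x, z, h₃, h₄, rfl⟩ := of_append h₁
    refine ⟨x, z, y, by simp, h₄, fun Δ' x' h' => ?_⟩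
    rw [← List.append_assoc]
    exact (h₃.append h').append h₂
  | node L c R ih =>
    intro Δ l h
    obtain ⟨w, y, h₁, h₂, rfl⟩ := of_append h
    obtain ⟨x, z, h₃, h₄, rfl⟩ := of_append h₁
    obtain ⟨z', h₅, rfl⟩ := h₄.of_bracket
    obtain ⟨L', w, R', rfl, h₆, h₇⟩ := ih h₅
    refine ⟨x ++ op () :: L', w, R' ++ cl () :: y, by simp, h₆, fun Δ' x' h' => ?_⟩
    have := (h₃.append (h₇ Δ' x' h').bracket).append h₂
    simpa [Ctx.fill] using this

end Realizes

/-- Cut becomes mere composition of memberships here. On labelled derivations it would be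
problematic, since the two premises may label the cut type differently. -/
theorem Provable.mem_interp {Γ : Hedge} {C : Ty} (h : Provable Γ C) :
    ∀ {l : List ETok}, Realizes Γ l → l ∈ C.interp := by
  induction h with
  | init i => exact fun h => h.of_single
  | ldivL c Γ A B C _ _ ih₁ ih₂ =>
    intro l h
    obtain ⟨L, x, R, rfl, h₁, h₂⟩ := Realizes.of_fill c h
    obtain ⟨y, z, h₃, h₄, rfl⟩ := h₁.of_append
    exact ih₂ (h₂ _ _ (.single (h₄.of_single.2 y (ih₁ h₃))))
  | ldivR Γ A B _ ih => exact fun h => ⟨h.bal, fun x hx => ih (.leaf hx h)⟩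
  | rdivL c Γ A B C _ _ ih₁ ih₂ =>
    intro l h
    obtain ⟨L, x, R, rfl, h₁, h₂⟩ := Realizes.of_fill c h
    obtain ⟨y, z, h₃, h₄, rfl⟩ := Realizes.of_append (Γ := [_]) h₁
    exact ih₂ (h₂ _ _ (.single (h₃.of_single.2 z (ih₁ h₄))))
  | rdivR Γ A B _ ih => exact fun h => ⟨h.bal, fun x hx => ih (h.append (.single hx))⟩
  | prodL c A B C _ ih =>
    intro l h
    have hb := h.bal
    obtain ⟨L, x, R, rfl, h₁, h₂⟩ := Realizes.of_fill c h
    refine Ty.mem_interp_of_phaseClosure h₁.of_single hb ?_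
    rintro _ ⟨y, hy, z, hz, rfl⟩
    exact ih (h₂ _ _ (.leaf hy (.single hz)))
  | prodR Γ Δ A B _ _ ih₁ ih₂ =>
    intro l h
    have hb := h.bal
    obtain ⟨x, y, h₁, h₂, rfl⟩ := h.of_append
    exact subset_phaseClosure hb ⟨x, ih₁ h₁, y, ih₂ h₂, rfl⟩
  | diaL c A C _ ih =>
    intro l h
    have hb := h.bal
    obtain ⟨L, x, R, rfl, h₁, h₂⟩ := Realizes.of_fill c h
    refine Ty.mem_interp_of_phaseClosure h₁.of_single hb ?_
    rintro _ ⟨y, hy, rfl⟩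
    exact ih (h₂ _ _ (Realizes.single hy).bracket)
  | diaR Γ A _ ih =>
    intro l h
    have hb := h.bal
    obtain ⟨y, h₁, rfl⟩ := h.of_bracket
    exact subset_phaseClosure hb ⟨y, ih h₁, rfl⟩
  | boxL c A C _ ih =>
    intro l h
    obtain ⟨L, x, R, rfl, h₁, h₂⟩ := Realizes.of_fill c h
    obtain ⟨y, h₃, rfl⟩ := h₁.of_bracket
    exact ih (h₂ _ _ (.single h₃.of_single.2))
  | boxR Γ A _ ih => exact fun h => ⟨h.bal, ih h.bracket⟩
  | oneL c C _ ih =>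
    intro l h
    have hb := h.bal
    obtain ⟨L, x, R, rfl, h₁, h₂⟩ := Realizes.of_fill c h
    refine Ty.mem_interp_of_phaseClosure h₁.of_single hb ?_
    rintro _ rfl
    exact ih (h₂ _ _ .nil)
  | oneR =>
    intro l h
    cases h
    exact subset_phaseClosure .nil rfl
  | cut c Γ A C _ _ ih₁ ih₂ =>
    intro l h
    obtain ⟨L, x, R, rfl, h₁, h₂⟩ := Realizes.of_fill c h
    exact ih₂ (h₂ _ _ (.single (ih₁ h₁)))

/-- Okada's argument, by induction on the type: each half uses the labelled left or right rules. The
unit alone would fail, as no labelled type erases to it, so ◇1 is a base case with its own rules. -/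
theorem Guarded.interp {B : Finset ℕ} {A : Ty} (h : Guarded B A) :
    [ty A] ∈ A.interp ∧ ∀ l ∈ A.interp, Labellable l A := by
  induction h with
  | base h =>
    rcases h with ⟨i, -, rfl⟩ | rfl
    · exact ⟨Labellable.init i, fun l hl => hl⟩
    · refine ⟨⟨Bal.single _, fun L R C hS => ?_⟩, fun l hl => ?_⟩
      · have := hS _ ⟨[], subset_phaseClosure .nil rfl, rfl⟩
        exact Labellable.unitDiaL (by simpa using this)
      · have := hl.2 [] [] (.dia .one) fun x hx => by
          obtain ⟨y, hy, rfl⟩ := hx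
          have := hy.2 [op ()] [cl ()] (.dia .one) fun z hz => by
            obtain rfl := hz
            exact Labellable.unitDiaR
          simpa using this
        simpa using this
  | ldiv _ _ ihA ihB =>
    refine ⟨⟨Bal.single _, fun x hx => Ty.interp_closed
      ((Ty.bal_of_mem_interp hx).append (Bal.single _)) fun L R C hS => ?_⟩, fun l hl => ?_⟩
    · simpa using Labellable.ldivL (ihA.2 x hx) (hS _ ihB.1)
    · exact Labellable.ldivR (ihB.2 _ (hl.2 _ ihA.1))
  | rdiv _ _ ihA ihB =>
    refine ⟨⟨Bal.single _, fun x hx => Ty.interp_closed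
      ((Bal.single _).append (Ty.bal_of_mem_interp hx)) fun L R C hS => ?_⟩, fun l hl => ?_⟩
    · simpa using Labellable.rdivL (ihA.2 x hx) (hS _ ihB.1)
    · exact Labellable.rdivR (ihB.2 _ (hl.2 _ ihA.1))
  | prod _ _ ihA ihB =>
    refine ⟨⟨Bal.single _, fun L R C hS => ?_⟩, fun l hl => ?_⟩
    · exact Labellable.prodL (hS _ ⟨_, ihA.1, _, ihB.1, rfl⟩)
    · have := hl.2 [] [] (.prod _ _) fun x hx => by
        obtain ⟨y, hy, z, hz, rfl⟩ := hx
        simpa using Labellable.prodR (ihA.2 y hy) (ihB.2 z hz)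
      simpa using this
  | dia _ ih =>
    refine ⟨⟨Bal.single _, fun L R C hS => ?_⟩, fun l hl => ?_⟩
    · exact Labellable.diaL (hS _ ⟨_, ih.1, rfl⟩)
    · have := hl.2 [] [] (.dia _) fun x hx => by
        obtain ⟨y, hy, rfl⟩ := hx
        simpa using Labellable.diaR (ih.2 y hy)
      simpa using this
  | box _ ih =>
    refine ⟨⟨Bal.single _, Ty.interp_closed ((Bal.single _).bracket ()) fun L R C hS => ?_⟩,
      fun l hl => Labellable.boxR hl.1 (ih.2 _ hl.2)⟩
    simpa using Labellable.boxL (hS _ ih.1)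

-- From provability to Cut derivations

theorem mem_hedgeYield_iff {A : Ty} (Γ : Hedge) : A ∈ hedgeYield Γ ↔ ty A ∈ flat Γ := by
  induction Γ using Hedge.rec' with
  | nil => simp [hedgeYield, flat_nil]
  | leaf D ts ih => simp [hedgeYield, Tree.yield, flat_leaf, ih]
  | node ts ts' ih ih' => simp [hedgeYield, Tree.yield, flat_node, ih, ih']

theorem realizes_flat {B : Finset ℕ} (Γ : Hedge) (h : ∀ A, ty A ∈ flat Γ → Guarded B A) :
    Realizes Γ (flat Γ) := by
  induction Γ using Hedge.rec' with
  | nil => rw [flat_nil]; exact .nil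
  | leaf A ts ih =>
    rw [flat_leaf] at *
    exact .leaf (x := [ty A]) (h A (by simp)).interp.1 (ih fun A' hA => h A' (by simp [hA]))
  | node ts ts' ih ih' =>
    rw [flat_node] at *
    exact .node (ih fun A hA => h A (by simp [hA])) (ih' fun A hA => h A (by simp [hA]))

theorem LTy.erase_ne_one (A : LTy) : A.erase ≠ .one := by
  cases A <;> simp [erase]

theorem LTy.prim_mem_of_guarded {B : Finset ℕ} {A : LTy} (h : Guarded B A.erase) :
    ∀ i x, .prim i x ∈ A.word → i ∈ B := by
  induction A with
  | prim i x =>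
    intro i' x' h'
    simp only [word, List.mem_singleton, Letter.prim.injEq] at h'
    cases h with
    | base h =>
      rcases h with ⟨j, hj, e⟩ | e
      · cases e
        exact h'.1 ▸ hj
      · cases e
  | unitDia j => intro i x h'; simp [word] at h'
  | ldiv A B ihA ihB =>
    cases h with
    | base h => rcases h with ⟨j, hj, e⟩ | e <;> cases e
    | ldiv hA hB =>
      intro i x h'
      simp only [word, List.mem_append, List.mem_reverse] at h'
      exact h'.elim (ihA hA i x) (ihB hB i x)
  | rdiv B A ihB ihA =>
    cases h with
    | base h => rcases h with ⟨j, hj, e⟩ | e <;> cases e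
    | rdiv hA hB =>
      intro i x h'
      simp only [word, List.mem_append, List.mem_reverse] at h'
      exact h'.elim (ihB hB i x) (ihA hA i x)
  | prod A B ihA ihB =>
    cases h with
    | base h => rcases h with ⟨j, hj, e⟩ | e <;> cases e
    | prod hA hB =>
      intro i x h'
      simp only [word, List.mem_append] at h'
      exact h'.elim (ihA hA i x) (ihB hB i x)
  | dia j A ih =>
    cases h with
    | base h =>
      rcases h with ⟨j, hj, e⟩ | e
      · cases e
      -- A labelled ◇ never erases to ◇1, which has its separate constructor.
      · exact absurd (Ty.dia.inj e) A.erase_ne_one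
    | dia hA => exact fun i x h' => ih hA i x (by simpa [word] using h')
  | box j A ih =>
    cases h with
    | base h => rcases h with ⟨j, hj, e⟩ | e <;> cases e
    | box hA => exact fun i x h' => ih hA i x (by simpa [word] using h')

/-- The notation of `Γ` realizes `Γ` in the phase model, since each guarded type realizes itself;
soundness then makes the sequent labellable, hence thin for some labelling. -/
theorem Provable.cutDerivable {B : Finset ℕ} {m : ℕ} {Γ : Hedge} {C : Ty} (h : Provable Γ C)
    (hΓ : ∀ A ∈ hedgeYield Γ, Guarded B A ∧ A.length ≤ m) (hC : Guarded B C ∧ C.length ≤ m) :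
    CutDerivable (setT B m) Γ C := by
  simp only [mem_hedgeYield_iff] at hΓ
  obtain ⟨_, l, C', -, e, rfl, d, c⟩ := hC.1.interp.2 _
    (h.mem_interp (realizes_flat Γ fun A hA => (hΓ A hA).1)) 0
  have hl : ∀ A, ty A ∈ l → Guarded B A.erase ∧ A.word.length ≤ m := fun A hA => by
    rw [A.length_word]
    exact hΓ _ (e ▸ List.mem_map_of_mem (f := eraseTok) hA)
  have hs : Small B m l := by
    refine ⟨fun i x hx => ?_, fun A hA => (hl A hA).2⟩
    obtain ⟨t, ht, hx⟩ := List.mem_flatMap.1 hx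
    cases t with
    | ty A => exact LTy.prim_mem_of_guarded (hl A ht).1 i x hx
    | op j => simp [tokWord] at hx
    | cl j => simp [tokWord] at hx
  have hsC : Small B m [ty C'] := ⟨fun i x hx => LTy.prim_mem_of_guarded hC.1 i x
    (by simpa [words_cons, words_nil, tokWord] using hx), by
      simpa [C'.length_word] using hC.2⟩
  obtain ⟨Γ', hΓ', hd⟩ := Thin.cutDerivable l.length le_rfl ⟨d, fun q => (c q).1⟩ hs hsC
  exact flat_injective (hΓ'.trans e) ▸ hd

-- Soundness of the axioms and finiteness

theorem Provable.refl (A : Ty) : Provable [.leaf A] A := by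
  induction A with
  | prim i => exact .init i
  | one => exact .oneL (.hole [] []) _ .oneR
  | ldiv A B ihA ihB => exact .ldivR _ _ _ (.ldivL (.hole [] []) [.leaf A] _ _ _ ihA ihB)
  | rdiv B A ihB ihA => exact .rdivR _ _ _ (.rdivL (.hole [] []) [.leaf A] _ _ _ ihA ihB)
  | prod A B ihA ihB =>
    exact .prodL (.hole [] []) _ _ _ (.prodR [.leaf A] [.leaf B] _ _ ihA ihB)
  | dia A ih => exact .diaL (.hole [] []) _ _ (.diaR _ _ ih)
  | box A ih => exact .boxR _ _ (.boxL (.hole [] []) _ _ ih)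

theorem CutDerivable.provable {B : Finset ℕ} {m : ℕ} {Γ : Hedge} {C : Ty}
    (h : CutDerivable (setT B m) Γ C) : Provable Γ C := by
  induction h with
  | mem Γ C h =>
    rcases h with ((⟨As, D, -, -, -, hp, e⟩ | e) | ⟨A, -, -, e⟩) | ⟨A, -, -, e⟩ <;> cases e
    · exact hp
    · exact .diaR _ _ .oneR
    · exact .diaR _ _ (.refl _)
    · exact .boxL (.hole [] []) _ _ (.refl _)
  | cut c Γ A C _ _ ih₁ ih₂ => exact .cut c Γ A C ih₁ ih₂

theorem Guarded.length_pos {B : Finset ℕ} {A : Ty} (h : Guarded B A) : 0 < A.length := by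
  induction h with
  | base h => rcases h with ⟨i, -, rfl⟩ | rfl <;> simp [Ty.length]
  | ldiv | rdiv | prod | dia | box => simp only [Ty.length]; omega

/-- A type of length zero could be combined with itself without end; with all lengths positive, both
parts of a binary type are strictly shorter than the whole, and induction on the bound works. -/
theorem finite_guarded (B : Finset ℕ) (m : ℕ) : {A | Guarded B A ∧ A.length ≤ m}.Finite := by
  induction m with
  | zero =>
    refine Set.Finite.subset Set.finite_empty fun A hA => ?_
    have := hA.1.length_pos
    have := hA.2
    omega
  | succ m ih =>
    refine (((((((B.finite_toSet.image Ty.prim).union (Set.finite_singleton (Ty.dia .one))).union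
      (ih.image2 Ty.ldiv ih)).union (ih.image2 Ty.rdiv ih)).union (ih.image2 Ty.prod ih)).union
      (ih.image Ty.dia)).union (ih.image Ty.box)).subset ?_
    rintro A ⟨hA, hm⟩
    cases hA with
    | base h => exact .inl (.inl (.inl (.inl (.inl h))))
    | ldiv h₁ h₂ =>
      have := Guarded.length_pos h₁
      have := Guarded.length_pos h₂
      simp only [Ty.length] at hm
      exact .inl (.inl (.inl (.inl (.inr ⟨_, ⟨h₁, by omega⟩, _, ⟨h₂, by omega⟩, rfl⟩))))
    | rdiv h₁ h₂ =>
      have := Guarded.length_pos h₁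
      have := Guarded.length_pos h₂
      simp only [Ty.length] at hm
      exact .inl (.inl (.inl (.inr ⟨_, ⟨h₂, by omega⟩, _, ⟨h₁, by omega⟩, rfl⟩)))
    | prod h₁ h₂ =>
      have := Guarded.length_pos h₁
      have := Guarded.length_pos h₂
      simp only [Ty.length] at hm
      exact .inl (.inl (.inr ⟨_, ⟨h₁, by omega⟩, _, ⟨h₂, by omega⟩, rfl⟩))
    | dia h =>
      simp only [Ty.length] at hm
      exact .inl (.inr ⟨_, ⟨h, by omega⟩, rfl⟩)
    | box h =>
      simp only [Ty.length] at hm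
      exact .inr ⟨_, ⟨h, by omega⟩, rfl⟩

theorem finite_setT (B : Finset ℕ) (m : ℕ) : (setT B m).Finite := by
  have hG := finite_guarded B m
  refine ((Set.Finite.union ?_ (Set.finite_singleton _)).union
    ((hG.image fun A => ⟨[.node [.leaf A]], .dia A⟩).subset ?_)).union
    ((hG.image fun A => ⟨[.node [.leaf (.box A)]], A⟩).subset ?_)
  · have hL : {As : List Ty | As.length ≤ 2 ∧ ∀ A ∈ As, Guarded B A ∧ A.length ≤ m}.Finite := by
      refine (((Set.finite_singleton []).union (hG.image fun A => [A])).union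
        (hG.image2 (fun A D => [A, D]) hG)).subset ?_
      rintro (_ | ⟨A, _ | ⟨D, _ | ⟨_, _⟩⟩⟩) ⟨h2, h⟩
      · exact .inl (.inl rfl)
      · exact .inl (.inr ⟨A, h A (by simp), rfl⟩)
      · exact .inr ⟨A, h A (by simp), D, h D (by simp), rfl⟩
      · simp at h2
    refine (hL.image2 (fun As C => ⟨As.map Tree.leaf, C⟩) hG).subset ?_
    rintro s ⟨As, C, h2, hAs, hC, -, rfl⟩
    exact ⟨As, ⟨h2, hAs⟩, C, hC, rfl⟩
  · rintro s ⟨A, hA, hm, rfl⟩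
    exact ⟨A, ⟨hA, by omega⟩, rfl⟩
  · rintro s ⟨A, hA, hm, rfl⟩
    exact ⟨A, ⟨hA, by omega⟩, rfl⟩

end LambekBrackets

theorem mainTheorem7 (B : Finset ℕ) (m : ℕ) :
    (LambekBrackets.setT B m).Finite ∧
    ∀ (Γ : LambekBrackets.Hedge) (C : LambekBrackets.Ty),
      (∀ A ∈ LambekBrackets.hedgeYield Γ, LambekBrackets.Guarded B A ∧ A.length ≤ m) →
      (LambekBrackets.Guarded B C ∧ C.length ≤ m) →
      (LambekBrackets.Provable Γ C ↔
        LambekBrackets.CutDerivable (LambekBrackets.setT B m) Γ C) :=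
  ⟨LambekBrackets.finite_setT B m, fun _ _ hΓ hC =>
    ⟨fun h => h.cutDerivable hΓ hC, fun h => h.provable⟩⟩
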